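/- Let $\Omega=\{(s,t)\in\mathbb R^2 : 0<s\le 1,\ 0<t\le 1,\ s+t>1\}$, and let $m$ be Lebesgue measure restricted to $\Omega$ and normalized to a probability measure. The BCZ map $$\Phi:\Omega\to\Omega,\qquad \Phi(s,t)=\bigl(t,\,-s+\lfloor (1+s)/t\rfloor\, t\bigr),$$ is weakly mixing with respect to $m$. That is, $\Phi$ preserves $m$ and is ergodic, and it has no non-constant eigenfunctions: if $f:\Omega\to\mathbb C$ is measurable and $f\circ\Phi=c f$ holds $m$-almost everywhere for some $c\in\mathbb C$, then $f$ is $m$-almost everywhere constant. -/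

import Mathlib

open MeasureTheory

/-- A measure-preserving transformation `T` of a probability space `(X, μ)` is weakly mixing if it
is ergodic and has no eigenfunctions other than the constants: every measurable complex-valued `f`
with `f ∘ T = c f` almost everywhere, for some complex number `c`, is almost everywhere constant.
(`Ergodic` includes that `T` is measurable and preserves `μ`.) -/
structure WeaklyMixing {X : Type*} [MeasurableSpace X] (T : X → X) (μ : Measure X)
    [IsProbabilityMeasure μ] : Prop where
  ergodic : Ergodic T μ
  const_of_eigenfunction : ∀ (c : ℂ) (f : X → ℂ), AEStronglyMeasurable f μ →
    (∀ᵐ x ∂μ, f (T x) = c * f x) → ∃ a : ℂ, ∀ᵐ x ∂μ, f x = a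

namespace BCZ

/-- The Farey triangle `Ω = {(s, t) : 0 < s, t ≤ 1, s + t > 1}`. -/
def Ω : Set (ℝ × ℝ) :=
  {p | 0 < p.1 ∧ p.1 ≤ 1 ∧ 0 < p.2 ∧ p.2 ≤ 1 ∧ 1 < p.1 + p.2}

/-- The BCZ formula `(s, t) ↦ (t, -s + ⌊(1 + s) / t⌋ t)` sends the triangle into itself. -/
theorem formula_mem {p : ℝ × ℝ} (hp : p ∈ Ω) :
    (p.2, -p.1 + (⌊(1 + p.1) / p.2⌋ : ℝ) * p.2) ∈ Ω := by
  obtain ⟨_, _, h3, h4, _⟩ := hp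
  have hle : (⌊(1 + p.1) / p.2⌋ : ℝ) * p.2 ≤ 1 + p.1 :=
    (le_div_iff₀ h3).1 (Int.floor_le _)
  have hlt : 1 + p.1 < ((⌊(1 + p.1) / p.2⌋ : ℝ) + 1) * p.2 :=
    (div_lt_iff₀ h3).1 (Int.lt_floor_add_one _)
  refine ⟨h3, h4, ?_, ?_, ?_⟩ <;> dsimp only <;> linarith

/-- The BCZ map `Φ (s, t) = (t, -s + ⌊(1 + s) / t⌋ t)` on the triangle. -/
noncomputable def Φ (p : Ω) : Ω :=
  ⟨(p.1.2, -p.1.1 + (⌊(1 + p.1.1) / p.1.2⌋ : ℝ) * p.1.2), formula_mem p.2⟩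

/-- Normalized Lebesgue measure on the triangle: `m A` is the area of `A ⊆ Ω` divided by the area
of `Ω`. -/
noncomputable def m : Measure Ω :=
  (volume Ω)⁻¹ • (volume : Measure (ℝ × ℝ)).comap Subtype.val

theorem measurableSet_Ω : MeasurableSet Ω := by
  unfold Ω
  measurability

theorem volume_Ω_ne_zero : volume Ω ≠ 0 := by
  have hsub : Set.Ioo (1 / 2 : ℝ) 1 ×ˢ Set.Ioo (1 / 2 : ℝ) 1 ⊆ Ω := by
    rintro ⟨s, t⟩ ⟨⟨h1, h2⟩, h3, h4⟩
    dsimp only at h1 h2 h3 h4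
    refine ⟨?_, ?_, ?_, ?_, ?_⟩ <;> dsimp only <;> linarith
  have hopen : IsOpen (Set.Ioo (1 / 2 : ℝ) 1 ×ˢ Set.Ioo (1 / 2 : ℝ) 1) := isOpen_Ioo.prod isOpen_Ioo
  have hpos := hopen.measure_pos (volume : Measure (ℝ × ℝ)) ⟨(3 / 4, 3 / 4), by norm_num⟩
  exact (hpos.trans_le (measure_mono hsub)).ne'

theorem volume_Ω_ne_top : volume Ω ≠ ⊤ := by
  have hsub : Ω ⊆ Set.Icc (0 : ℝ × ℝ) 1 := by
    rintro ⟨s, t⟩ ⟨h1, h2, h3, h4, _⟩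
    exact ⟨⟨h1.le, h3.le⟩, ⟨h2, h4⟩⟩
  exact measure_ne_top_of_subset hsub isCompact_Icc.measure_lt_top.ne

instance : IsProbabilityMeasure m where
  measure_univ := by
    rw [m, Measure.smul_apply, smul_eq_mul, comap_subtype_coe_apply measurableSet_Ω,
      Set.image_univ, Subtype.range_coe]
    exact ENNReal.inv_mul_cancel volume_Ω_ne_zero volume_Ω_ne_top

end BCZ

/-! Up to null sets, both halves of the theorem come from viewing a point of the triangle as a pair
of values of a basis of `ℤ²`. One step of `Φ` is an integral change of basis of determinant one.

Ergodicity: two points of the triangle lie on one `Φ`-orbit exactly when `SL(2, ℤ)` relates them, so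
an invariant set is the trace of an `SL(2, ℤ)`-invariant set of the plane (`mem_saturation_iff`).
The plane action is ergodic (`SLInvariant.ae_mem_or_ae_notMem`). The argument uses Lebesgue points
along rational approximations. Parabolic elements force the mass of an invariant set on almost every
ray to be proportional to height, and further elements of `SL(2, ℤ)` force the proportionality
constant to agree on almost all rays.

Eigenvalues: let `f` be unimodular with `f ∘ Φ = c f`, and compare `f` with its dilate `f (· / L)`,
where `L = 1 - ε`. As long as the orbit stays in `L • Ω` the dilate obeys the same equation, so the
size of the difference is constant. When the orbit crosses the strip `s > L`, the dilated orbit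
skips one point, and the two functions get out of step by a factor `c`. Hence on one side of the
crossing the truncated difference is at least half of `min 1 ‖c - 1‖` (`min_le_defect_add_defect`).
From a subset of the strip of area at least `ε / 5`, the orbit does not meet the strip again up to
flow time `N`, of order `1 / ε`. The corresponding disjoint tower, weighted by `roof`, keeps the
defect integral away from zero when `c ≠ 1` (`mul_vol_base_le`). But dilation is continuous in `L¹`
and `roof` is integrable, so along a sequence this integral tends to zero. Thus `c = 1`, and
ergodicity finishes the proof. -/

namespace BCZ

/-! ### Reversibility and area preservation. -/

/-- The reflection of the Farey triangle in the diagonal. -/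
def swap (p : Ω) : Ω :=
  ⟨(p.1.2, p.1.1), p.2.2.2.1, p.2.2.2.2.1, p.2.1, p.2.2.1, by
    have := p.2.2.2.2.2; dsimp only; linarith⟩

@[simp] theorem swap_fst (p : Ω) : (swap p).1.1 = p.1.2 := rfl
@[simp] theorem swap_snd (p : Ω) : (swap p).1.2 = p.1.1 := rfl
@[simp] theorem swap_swap (p : Ω) : swap (swap p) = p := rfl
@[simp] theorem Φ_fst (p : Ω) : (Φ p).1.1 = p.1.2 := rfl

theorem Φ_snd (p : Ω) : (Φ p).1.2 = -p.1.1 + (⌊(1 + p.1.1) / p.1.2⌋ : ℝ) * p.1.2 := rfl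

/-- The half-open interval `(1 - t, 1]` has length `t`, so exactly one number `-s + k t` falls into
it. -/
theorem floor_eq {p : Ω} {y : ℝ} {k : ℤ} (hy : y = -p.1.1 + k * p.1.2) (h1 : y ≤ 1)
    (h2 : 1 < p.1.2 + y) : ⌊(1 + p.1.1) / p.1.2⌋ = k := by
  have h3 := p.2.2.2.1
  rw [Int.floor_eq_iff, le_div_iff₀ h3, div_lt_iff₀ h3]
  constructor <;> nlinarith

/-- The image of a point under `Φ` is determined by lying in the triangle. -/
theorem Φ_eq {p q : Ω} (k : ℤ) (h1 : q.1.1 = p.1.2) (h2 : q.1.2 = -p.1.1 + k * p.1.2) :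
    Φ p = q := by
  have hk := floor_eq h2 q.2.2.2.2.1 (by have := q.2.2.2.2.2; rw [h1] at this; exact this)
  apply Subtype.ext
  apply Prod.ext
  · exact h1.symm
  · rw [Φ_snd, hk, h2]

/-- Time reversal: the same integer `k` leads back. It makes `swap ∘ Φ` an involution and `swap` a
conjugacy from `Φ` to its inverse, which later turns forward estimates into backward ones. -/
theorem Φ_swap_Φ (p : Ω) : Φ (swap (Φ p)) = swap p := by
  apply Φ_eq ⌊(1 + p.1.1) / p.1.2⌋
  · simp
  · simp [Φ_snd]

theorem measurable_swap : Measurable swap := by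
  unfold swap
  fun_prop

theorem measurable_Φ : Measurable Φ := by
  unfold Φ
  refine Measurable.subtype_mk ?_
  have h1 : Measurable fun p : Ω => p.1.1 := by fun_prop
  have h2 : Measurable fun p : Ω => p.1.2 := by fun_prop
  have h3 : Measurable fun p : Ω => (⌊(1 + p.1.1) / p.1.2⌋ : ℝ) :=
    (measurable_from_top (f := fun k : ℤ => (k : ℝ))).comp
      (Int.measurable_floor.comp (by fun_prop))
  fun_prop

/-- Lebesgue measure on the triangle. -/
noncomputable def vol : Measure Ω := (volume : Measure (ℝ × ℝ)).comap Subtype.val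

theorem m_eq : m = (volume Ω)⁻¹ • vol := rfl

theorem vol_apply (s : Set Ω) : vol s = volume (Subtype.val '' s) :=
  comap_subtype_coe_apply measurableSet_Ω _ _

theorem measurePreserving_val : MeasurePreserving (Subtype.val : Ω → ℝ × ℝ) vol
    (volume.restrict Ω) :=
  ⟨measurable_subtype_coe, by rw [vol, map_comap_subtype_coe measurableSet_Ω]⟩

theorem lintegral_vol (f : ℝ × ℝ → ENNReal) : ∫⁻ p, f p.1 ∂vol = ∫⁻ x in Ω, f x :=
  lintegral_subtype_comap measurableSet_Ω f

instance : IsFiniteMeasure vol := ⟨by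
  rw [vol_apply, Set.image_univ, Subtype.range_coe]
  exact lt_top_iff_ne_top.2 volume_Ω_ne_top⟩

theorem ae_m_iff {P : Ω → Prop} : (∀ᵐ p ∂m, P p) ↔ ∀ᵐ p ∂vol, P p := by
  rw [m_eq, Measure.ae_ennreal_smul_measure_iff]
  exact ENNReal.inv_ne_zero.2 volume_Ω_ne_top

/-- A linear change of coordinates of determinant `±1` preserves the area. -/
theorem measurePreserving_linear {a b c d : ℝ} (h : |a * d - b * c| = 1) :
    MeasurePreserving (fun v : ℝ × ℝ => (a * v.1 + b * v.2, c * v.1 + d * v.2)) := by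
  refine ⟨by fun_prop, ?_⟩
  set l := Matrix.toLin (Module.Basis.finTwoProd ℝ) (Module.Basis.finTwoProd ℝ) !![a, b; c, d]
  have hl : (fun v : ℝ × ℝ => (a * v.1 + b * v.2, c * v.1 + d * v.2)) = l := by
    ext v <;> simp [l, Matrix.toLin_finTwoProd_apply]
  have hdet : LinearMap.det l = a * d - b * c := by
    rw [LinearMap.det_toLin, Matrix.det_fin_two_of]
  rw [hl, Measure.map_linearMap_addHaar_eq_smul_addHaar, hdet, abs_inv, h]
  · simp
  · rw [hdet]; intro h0; rw [h0] at h; simp at h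

theorem measurePreserving_swap : MeasurePreserving swap vol vol := by
  refine ⟨measurable_swap, ?_⟩
  ext s hs
  rw [Measure.map_apply measurable_swap hs, vol_apply, vol_apply]
  have hmeas : MeasurableSet (Subtype.val '' s) := measurableSet_Ω.subtype_image hs
  have hmp := measurePreserving_linear (a := 0) (b := 1) (c := 1) (d := 0) (by norm_num)
  rw [← hmp.measure_preimage hmeas.nullMeasurableSet]
  congr 1
  ext v
  simp only [Set.mem_image, Set.mem_preimage, zero_mul, one_mul, zero_add, add_zero]
  constructor
  · rintro ⟨p, hp, rfl⟩
    exact ⟨_, hp, rfl⟩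
  · rintro ⟨p, hp, h⟩
    refine ⟨swap p, by simpa using hp, ?_⟩
    ext <;> simp [h]

/-- The involution `(s, t) ↦ (-s + ⌊(1 + s) / t⌋ t, t)` preserves the area. -/
theorem measurePreserving_swap_comp_Φ : MeasurePreserving (swap ∘ Φ) vol vol := by
  have hm : Measurable (swap ∘ Φ) := measurable_swap.comp measurable_Φ
  refine ⟨hm, ?_⟩
  ext s hs
  rw [Measure.map_apply hm hs]
  set κ : Ω → ℤ := fun p => ⌊(1 + p.1.1) / p.1.2⌋ with hκ
  have hκm : Measurable κ := Int.measurable_floor.comp (by fun_prop)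
  have hinv : ∀ p, (swap ∘ Φ) ((swap ∘ Φ) p) = p := fun p => by
    simp [Φ_swap_Φ]
  -- The involution maps each level set of `κ` to itself, and acts there as a linear map of
  -- determinant `-1`.
  have hκinv : ∀ p, κ ((swap ∘ Φ) p) = κ p := fun p => by
    apply floor_eq (y := p.1.1) ?_ p.2.2.1 ?_
    · simp [Φ_snd, κ]
    · have := p.2.2.2.2.2
      simp only [Function.comp_apply, swap_snd, Φ_fst]
      linarith
  have hpart : ∀ t : Set Ω, MeasurableSet t → vol t = ∑' k : ℤ, vol (t ∩ κ ⁻¹' {k}) := by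
    intro t ht
    rw [← measure_iUnion]
    · congr 1
      ext p; simp
    · intro i j hij
      refine Set.disjoint_left.2 ?_
      rintro p ⟨-, h1⟩ ⟨-, h2⟩
      exact hij (h1.symm.trans h2)
    · exact fun k => ht.inter (hκm (measurableSet_singleton k))
  rw [hpart _ (hm hs), hpart s hs]
  congr 1
  ext1 k
  have hsk : MeasurableSet (s ∩ κ ⁻¹' {k}) := hs.inter (hκm (measurableSet_singleton k))
  have hmeas : MeasurableSet (Subtype.val '' (s ∩ κ ⁻¹' {k})) := measurableSet_Ω.subtype_image hsk
  have hmp := measurePreserving_linear (a := -1) (b := k) (c := 0) (d := 1) (by norm_num)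
  rw [vol_apply, vol_apply, ← hmp.measure_preimage hmeas.nullMeasurableSet]
  have hform : ∀ p, κ p = k → ((swap ∘ Φ) p).1 = (-1 * p.1.1 + k * p.1.2, 0 * p.1.1 + 1 * p.1.2) := by
    intro p hp
    ext
    · simp [Φ_snd, ← hp, κ]
    · simp
  congr 1
  ext v
  simp only [Set.mem_preimage]
  constructor
  · rintro ⟨p, ⟨hp, hk⟩, rfl⟩
    exact ⟨_, ⟨hp, (hκinv p).trans hk⟩, hform p hk⟩
  · rintro ⟨p, ⟨hp, hk⟩, h⟩
    refine ⟨(swap ∘ Φ) p, ⟨by rw [Set.mem_preimage, hinv]; exact hp, (hκinv p).trans hk⟩, ?_⟩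
    rw [hform p hk, h]
    ext <;> simp

theorem measurePreserving_Φ_vol : MeasurePreserving Φ vol vol :=
  measurePreserving_swap.comp measurePreserving_swap_comp_Φ

theorem measurePreserving_Φ : MeasurePreserving Φ m m := by
  rw [m_eq]
  exact measurePreserving_Φ_vol.smul_measure _

/-- The inverse of `Φ`. -/
noncomputable def Ψ (p : Ω) : Ω := swap (Φ (swap p))

theorem Ψ_Φ (p : Ω) : Ψ (Φ p) = p := by simp [Ψ, Φ_swap_Φ]

theorem Φ_Ψ (p : Ω) : Φ (Ψ p) = p := by simp [Ψ, Φ_swap_Φ]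

theorem measurePreserving_Ψ : MeasurePreserving Ψ vol vol :=
  measurePreserving_swap.comp (measurePreserving_Φ_vol.comp measurePreserving_swap)

end BCZ

/-! ### Lebesgue points along rational approximations. -/

section Approximation
open Filter Topology Set

/-- Every irrational number is approached by rationals `z n` with unbounded denominators at
distance at most `(z n).den⁻²`. -/
theorem Irrational.exists_seq_rat {t : ℝ} (ht : Irrational t) :
    ∃ z : ℕ → ℚ, Tendsto (fun n => ((z n).den : ℝ)) atTop atTop ∧
      ∀ n, |t - z n| ≤ 1 / ((z n).den : ℝ) ^ 2 := by
  have h1 : ∀ n : ℕ, ∃ q : ℚ, |t - q| ≤ 1 / (((n + 1 : ℕ) + 1 : ℝ) * q.den) ∧ q.den ≤ n + 1 :=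
    fun n => Real.exists_rat_abs_sub_le_and_den_le t n.succ_pos
  choose z hz1 hz2 using h1
  have hden : ∀ n, (1 : ℝ) ≤ (z n).den := fun n => by exact_mod_cast (z n).den_pos
  refine ⟨z, ?_, fun n => ?_⟩
  · refine tendsto_natCast_atTop_atTop.comp (tendsto_atTop.2 fun B => ?_)
    have h2 := ht.eventually_forall_le_dist_cast_rat_of_den_le B
    -- Rationals of bounded denominator keep a positive distance from `t`. The factor 2 makes the
    -- clash with the Dirichlet bound strict.
    have h3 : Tendsto (fun n : ℕ => 2 * (1 / ((n : ℝ) + 1))) atTop (𝓝 0) := by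
      simpa using tendsto_one_div_add_atTop_nhds_zero_nat.const_mul (2 : ℝ)
    filter_upwards [h3.eventually h2] with n hn
    by_contra hB
    have h4 := hn (z n) (le_of_not_ge hB)
    rw [Real.dist_eq] at h4
    have h5 : 1 / (((n + 1 : ℕ) + 1 : ℝ) * (z n).den) ≤ 1 / ((n : ℝ) + 1) := by
      apply one_div_le_one_div_of_le (by positivity)
      push_cast
      nlinarith [hden n, (Nat.cast_nonneg n : (0 : ℝ) ≤ n)]
    have h6 : 0 < 1 / ((n : ℝ) + 1) := by positivity
    linarith [hz1 n]
  · refine (hz1 n).trans (one_div_le_one_div_of_le (by nlinarith [hden n]) ?_)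
    have : ((z n).den : ℝ) ≤ n + 1 := by exact_mod_cast hz2 n
    push_cast
    nlinarith [hden n]

/-- Substitution `t = z + 1 / (q² σ)` in an integral of a nonnegative function. -/
theorem setIntegral_comp_inv_le {ψ : ℝ → ℝ} (hψ : Measurable ψ) (h0 : ∀ t, 0 ≤ ψ t) {C : ℝ}
    (hC : ∀ t, ψ t ≤ C) (z : ℝ) {q s₁ s₂ : ℝ} (hq : 0 < q) (h1 : 0 < s₁) :
    ∫ σ in Icc s₁ s₂, ψ (z + 1 / (q ^ 2 * σ)) ≤
      q ^ 2 * s₂ ^ 2 * ∫ t in Metric.closedBall z (1 / (q ^ 2 * s₁)), ψ t := by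
  set F : ℝ → ℝ := fun σ => z + 1 / (q ^ 2 * σ)
  have hpos : ∀ σ ∈ Icc s₁ s₂, 0 < σ := fun σ hσ => h1.trans_le hσ.1
  have hder : ∀ σ ∈ Icc s₁ s₂, HasDerivWithinAt F (-(1 / (q ^ 2 * σ ^ 2))) (Icc s₁ s₂) σ := by
    intro σ hσ
    have hσ0 := (hpos σ hσ).ne'
    have := ((hasDerivAt_inv hσ0).const_mul (1 / q ^ 2)).const_add z
    refine (this.congr_deriv ?_).hasDerivWithinAt.congr_of_mem ?_ hσ
    · field_simp
    · intro x hx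
      have := (hpos x hx).ne'
      simp only [F]; field_simp
  have hinj : InjOn F (Icc s₁ s₂) := by
    intro x hx y hy hxy
    have hx0 := (hpos x hx).ne'
    have hy0 := (hpos y hy).ne'
    simp only [F] at hxy
    field_simp at hxy
    linarith
  have hbd : ∀ (s : Set ℝ), volume s ≠ ⊤ → ∀ f : ℝ → ℝ, Measurable f →
      IntegrableOn (fun x => ψ (f x)) s := by
    intro s hs f hf
    refine Measure.integrableOn_of_bounded (M := C) hs (hψ.comp hf).aestronglyMeasurable ?_
    exact Eventually.of_forall fun x => by
      rw [Real.norm_of_nonneg (h0 _)]; exact hC _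
  have himg : F '' Icc s₁ s₂ ⊆ Metric.closedBall z (1 / (q ^ 2 * s₁)) := by
    rintro _ ⟨σ, hσ, rfl⟩
    have := hpos σ hσ
    simp only [F, Metric.mem_closedBall, Real.dist_eq, add_sub_cancel_left]
    rw [abs_of_pos (by positivity)]
    exact one_div_le_one_div_of_le (by positivity) (by gcongr; exact hσ.1)
  have hFm : Measurable F := by simp only [F]; fun_prop
  have hkey := integral_image_eq_integral_abs_deriv_smul measurableSet_Icc hder hinj ψ
  have h3 : ∫ t in F '' Icc s₁ s₂, ψ t ≤ ∫ t in Metric.closedBall z (1 / (q ^ 2 * s₁)), ψ t := by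
    refine setIntegral_mono_set
      (hbd _ measure_closedBall_lt_top.ne id measurable_id)
      (Eventually.of_forall h0) (Eventually.of_forall himg)
  rcases lt_or_ge s₂ s₁ with h12 | h12
  · rw [Icc_eq_empty (not_le.2 h12)]
    simp only [Measure.restrict_empty, integral_zero_measure]
    exact mul_nonneg (by positivity) (integral_nonneg h0)
  have h2 : 0 < s₂ := h1.trans_le h12
  calc ∫ σ in Icc s₁ s₂, ψ (F σ)
      ≤ ∫ σ in Icc s₁ s₂, q ^ 2 * s₂ ^ 2 * (|-(1 / (q ^ 2 * σ ^ 2))| • ψ (F σ)) := by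
        have hi := hbd (Icc s₁ s₂) measure_Icc_lt_top.ne F hFm
        refine setIntegral_mono_on hi ?_ measurableSet_Icc ?_
        · have hc : ContinuousOn (fun σ : ℝ => q ^ 2 * s₂ ^ 2 * |-(1 / (q ^ 2 * σ ^ 2))|)
              (Icc s₁ s₂) := by
            refine ContinuousOn.mul continuousOn_const (ContinuousOn.abs (ContinuousOn.neg ?_))
            refine ContinuousOn.div continuousOn_const (by fun_prop) ?_
            intro x hx
            have := hpos x hx
            positivity
          have := hi.continuousOn_mul hc isCompact_Icc
          refine this.congr_fun (fun x _ => ?_) measurableSet_Icc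
          simp only [smul_eq_mul, mul_assoc]
        · intro σ hσ
          have hσ0 := hpos σ hσ
          rw [abs_neg, abs_of_pos (by positivity), smul_eq_mul, ← mul_assoc]
          -- The normalized Jacobian is `s₂² / σ²`, which is at least one on the interval.
          refine le_mul_of_one_le_left (h0 _) ?_
          rw [mul_one_div, le_div_iff₀ (by positivity), one_mul]
          gcongr
          exact hσ.2
    _ = q ^ 2 * s₂ ^ 2 * ∫ t in F '' Icc s₁ s₂, ψ t := by
        rw [hkey, integral_const_mul]
    _ ≤ _ := by gcongr

/-- Almost every point is a Lebesgue point along the rescaled neighbourhoods of its rational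
approximations. -/
theorem ae_tendsto_integral_approx {φ : ℝ → ℝ} (hφ : Measurable φ) {C : ℝ}
    (hC : ∀ t, |φ t| ≤ C) :
    ∀ᵐ t₀ : ℝ, ∀ z : ℕ → ℚ, Tendsto (fun n => ((z n).den : ℝ)) atTop atTop →
      (∀ n, |t₀ - z n| ≤ 1 / ((z n).den : ℝ) ^ 2) → ∀ s₁ s₂ : ℝ, 0 < s₁ → s₁ ≤ s₂ →
      Tendsto (fun n => ∫ σ in s₁..s₂, |φ (z n + 1 / (((z n).den : ℝ) ^ 2 * σ)) - φ t₀|)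
        atTop (𝓝 0) := by
  have hloc : LocallyIntegrable φ := by
    intro x
    refine ⟨Metric.closedBall x 1, Metric.closedBall_mem_nhds x one_pos, ?_⟩
    exact Measure.integrableOn_of_bounded (M := C) measure_closedBall_lt_top.ne
      hφ.aestronglyMeasurable (Eventually.of_forall hC)
  have h := ae_all_iff.2 fun K : ℕ =>
    IsUnifLocDoublingMeasure.ae_tendsto_average_norm_sub (μ := volume) hloc K
  filter_upwards [h] with t₀ ht₀ z hz hzt s₁ s₂ h1 h12
  simp only [intervalIntegral.integral_of_le h12, ← integral_Icc_eq_integral_Ioc]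
  obtain ⟨K, hK⟩ := exists_nat_ge s₁
  have hden : ∀ n, 0 < ((z n).den : ℝ) := fun n => by exact_mod_cast (z n).den_pos
  have hδ : Tendsto (fun n => 1 / (((z n).den : ℝ) ^ 2 * s₁)) atTop (𝓝[>] 0) := by
    refine tendsto_nhdsWithin_iff.2 ⟨?_, Eventually.of_forall fun n => ?_⟩
    · have h2 : Tendsto (fun n => ((z n).den : ℝ) ^ 2 * s₁) atTop atTop :=
        ((tendsto_pow_atTop two_ne_zero).comp hz).atTop_mul_const h1
      simpa only [one_div, Function.comp_def] using tendsto_inv_atTop_zero.comp h2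
    · have := hden n
      exact mem_Ioi.2 (by positivity)
  -- The balls are centred at `z n`, not at `t₀`, but `t₀` is within `s₁ ≤ K` radii of the centre,
  -- which the doubling form of Lebesgue differentiation allows.
  have h3 := ht₀ K (fun n => (z n : ℝ)) _ hδ (Eventually.of_forall fun n => by
    rw [Metric.mem_closedBall, Real.dist_eq]
    refine (hzt n).trans ?_
    have := hden n
    rw [mul_one_div, div_le_div_iff₀ (by positivity) (by positivity)]
    nlinarith [sq_nonneg ((z n).den : ℝ)])
  have h4 := h3.const_mul (2 * s₂ ^ 2 / s₁)
  rw [mul_zero] at h4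
  refine squeeze_zero (fun n => integral_nonneg fun _ => abs_nonneg _) (fun n => ?_) h4
  have hdn := hden n
  refine (setIntegral_comp_inv_le (ψ := fun t => |φ t - φ t₀|) (C := C + C)
    ((hφ.sub_const _).abs) (fun _ => abs_nonneg _) (fun t => ?_) _ hdn h1).trans ?_
  · exact (abs_sub _ _).trans (add_le_add (hC _) (hC _))
  · rw [setAverage_eq, Real.volume_real_closedBall (by positivity), smul_eq_mul]
    simp only [Real.norm_eq_abs]
    apply le_of_eq
    field_simp

end Approximation

/-! ### Ergodicity of `SL(2, ℤ)` on the upper half plane. -/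

section PlaneErgodicity
open Filter Topology Set

/-- Invariance of a set of the plane under the linear action of `SL(2, ℤ)`. -/
def SLInvariant (S : Set (ℝ × ℝ)) : Prop :=
  ∀ p q r s : ℤ, p * s - q * r = 1 → ∀ x y : ℝ,
    ((p * x + q * y, r * x + s * y) ∈ S ↔ (x, y) ∈ S)

/-- The indicator function of `S` in the coordinates `(t, y) = (x / y, y)`. -/
noncomputable def coneIndicator (S : Set (ℝ × ℝ)) (t y : ℝ) : ℝ :=
  S.indicator (fun _ => 1) (t * y, y)

/-- The integral of `coneIndicator S t` from the origin up to height `s`. -/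
noncomputable def rayIntegral (S : Set (ℝ × ℝ)) (s t : ℝ) : ℝ :=
  ∫ y in (0 : ℝ)..s, coneIndicator S t y

variable {S : Set (ℝ × ℝ)}

theorem coneIndicator_abs_le (t y : ℝ) : |coneIndicator S t y| ≤ 1 := by
  unfold coneIndicator
  by_cases h : (t * y, y) ∈ S <;> simp [h]

theorem measurable_coneIndicator (hS : MeasurableSet S) :
    Measurable (Function.uncurry (coneIndicator S)) := by
  have h : Measurable fun p : ℝ × ℝ => (p.1 * p.2, p.2) := by fun_prop
  exact (measurable_const.indicator hS).comp h

theorem measurable_coneIndicator_right (hS : MeasurableSet S) (t : ℝ) :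
    Measurable (coneIndicator S t) :=
  (measurable_coneIndicator hS).comp measurable_prodMk_left

theorem intervalIntegrable_of_abs_le {f : ℝ → ℝ} (hf : Measurable f) {C : ℝ}
    (hC : ∀ x, |f x| ≤ C) (a b : ℝ) : IntervalIntegrable f volume a b := by
  rw [intervalIntegrable_iff]
  exact Measure.integrableOn_of_bounded (M := C) measure_Ioc_lt_top.ne
    hf.aestronglyMeasurable (Eventually.of_forall hC)

theorem measurable_rayIntegral (hS : MeasurableSet S) (s : ℝ) : Measurable (rayIntegral S s) := by
  have h := (measurable_coneIndicator hS).stronglyMeasurable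
  unfold rayIntegral
  simp only [intervalIntegral]
  exact (h.integral_prod_right.measurable).sub h.integral_prod_right.measurable

theorem rayIntegral_sub_le (hS : MeasurableSet S) (s s' t : ℝ) :
    |rayIntegral S s t - rayIntegral S s' t| ≤ |s - s'| := by
  have hi := intervalIntegrable_of_abs_le (measurable_coneIndicator_right hS t)
    (coneIndicator_abs_le t)
  unfold rayIntegral
  rw [intervalIntegral.integral_interval_sub_left (hi _ _) (hi _ _)]
  have := intervalIntegral.norm_integral_le_of_norm_le_const (a := s') (b := s)
    (f := coneIndicator S t) (C := 1) (fun y _ => coneIndicator_abs_le t y)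
  simpa using this

theorem rayIntegral_zero (t : ℝ) : rayIntegral S 0 t = 0 := by simp [rayIntegral]

theorem rayIntegral_abs_le (hS : MeasurableSet S) (s t : ℝ) : |rayIntegral S s t| ≤ |s| := by
  simpa [rayIntegral_zero] using rayIntegral_sub_le hS s 0 t

/-- The matrix carries the ray with parameter `t` to the ray with parameter `t'` and multiplies
heights by `c`, so this is the substitution `y ↦ c y`. -/
theorem SLInvariant.rayIntegral_moebius (hinv : SLInvariant S) {p q r s : ℤ}
    (h : p * s - q * r = 1) {t t' c : ℝ} (hc : c = r * t + s) (ht' : t' * c = p * t + q) (w : ℝ) :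
    rayIntegral S (c * w) t' = c * rayIntegral S w t := by
  have hG : ∀ y, coneIndicator S t' (c * y) = coneIndicator S t y := by
    intro y
    have h1 := hinv p q r s h (t * y) y
    have h2 : ((p : ℝ) * (t * y) + q * y, (r : ℝ) * (t * y) + s * y) = (t' * (c * y), c * y) := by
      ext
      · linear_combination (-y) * ht'
      · linear_combination (-y) * hc
    rw [h2] at h1
    unfold coneIndicator
    by_cases h3 : (t * y, y) ∈ S
    · rw [indicator_of_mem h3, indicator_of_mem (h1.2 h3)]
    · rw [indicator_of_notMem h3, indicator_of_notMem (fun h4 => h3 (h1.1 h4))]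
  unfold rayIntegral
  simp_rw [← hG]
  rw [intervalIntegral.mul_integral_comp_mul_left, mul_zero]

/-- The parabolic element fixing the rational `z` is the translation `σ ↦ σ + 1` in the coordinate
`t = z + 1 / (q² σ)`. -/
theorem SLInvariant.rayIntegral_parabolic (hinv : SLInvariant S) (z : ℚ) {σ : ℝ} (hσ : 0 < σ)
    (w : ℝ) :
    rayIntegral S ((σ + 1) / σ * w) (z + 1 / ((z.den : ℝ) ^ 2 * (σ + 1))) =
      (σ + 1) / σ * rayIntegral S w (z + 1 / ((z.den : ℝ) ^ 2 * σ)) := by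
  have hq : (z.den : ℝ) ≠ 0 := by exact_mod_cast z.den_pos.ne'
  have hz : (z : ℝ) = z.num / z.den := by exact_mod_cast (Rat.num_div_den z).symm
  refine hinv.rayIntegral_moebius (p := 1 + z.num * z.den) (q := -z.num ^ 2)
    (r := (z.den : ℤ) ^ 2) (s := 1 - z.num * z.den) (by ring) ?_ ?_ w
  · push_cast; rw [hz]; field_simp; ring
  · push_cast; rw [hz]; field_simp; ring

theorem SLInvariant.rayIntegral_one_periodic (hinv : SLInvariant S) :
    Function.Periodic (rayIntegral S 1) 1 := by
  intro t
  have := hinv.rayIntegral_moebius (p := 1) (q := 1) (r := 0) (s := 1) (by norm_num)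
    (t := t) (t' := t + 1) (c := 1) (by norm_num) (by norm_num) 1
  simpa using this

theorem ae_irrational : ∀ᵐ t : ℝ, Irrational t :=
  (countable_range ((↑) : ℚ → ℝ)).ae_notMem volume

/-- On almost every ray the integral is proportional to the height. -/
theorem SLInvariant.ae_rayIntegral_eq (hinv : SLInvariant S) (hS : MeasurableSet S) :
    ∀ᵐ t : ℝ, ∀ s : ℝ, 0 < s → rayIntegral S s t = s * rayIntegral S 1 t := by
  have hLP := ae_all_iff.2 fun s : ℚ => ae_tendsto_integral_approx (measurable_rayIntegral hS s)
    (rayIntegral_abs_le hS s)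
  filter_upwards [hLP, ae_irrational] with t₀ ht₀ hti
  obtain ⟨z, hz, hzt⟩ := hti.exists_seq_rat
  have key : ∀ s s' : ℚ, 0 < s → s < s' →
      (s' / s : ℝ) * rayIntegral S s t₀ = rayIntegral S s' t₀ := by
    intro s s' hs0 hss
    have hs : (0 : ℝ) < s := by exact_mod_cast hs0
    have hss' : (s : ℝ) < s' := by exact_mod_cast hss
    -- Chosen so that `(σ₀ + 1) / σ₀ = s' / s`: at `σ₀` the parabolic element takes height `s` to
    -- height `s'`. Lebesgue points give information only in mean, so the relation is averaged over
    -- a window `[σ₀, σ₀ + η]`, with an error per point of order `η` from the Lipschitz bound.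
    set σ₀ : ℝ := s / (s' - s) with hσ₀
    have hσpos : 0 < σ₀ := div_pos hs (sub_pos.2 hss')
    have hl : (s' / s : ℝ) = 1 + 1 / σ₀ := by
      have : (s' - s : ℝ) ≠ 0 := (sub_pos.2 hss').ne'
      rw [hσ₀]; field_simp; ring
    set D := |(s' / s : ℝ) * rayIntegral S s t₀ - rayIntegral S s' t₀| with hD
    have hDle : ∀ η : ℝ, 0 < η → D ≤ 2 * s * η / σ₀ ^ 2 := by
      intro η hη
      have h1 := ht₀ s z hz hzt σ₀ (σ₀ + η) hσpos (by linarith)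
      have h2 := ht₀ s' z hz hzt (σ₀ + 1) (σ₀ + η + 1) (by linarith) (by linarith)
      have h3 := ((h1.const_mul (s' / s : ℝ)).add h2).add_const (η * (2 * s * η / σ₀ ^ 2))
      have h4 : ∀ n, η * D ≤ (s' / s : ℝ) *
          (∫ σ in σ₀..(σ₀ + η), |rayIntegral S s (z n + 1 / (((z n).den : ℝ) ^ 2 * σ))
            - rayIntegral S s t₀|) +
          (∫ σ in (σ₀ + 1)..(σ₀ + η + 1),
            |rayIntegral S s' (z n + 1 / (((z n).den : ℝ) ^ 2 * σ)) - rayIntegral S s' t₀|) +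
          η * (2 * s * η / σ₀ ^ 2) := by
        intro n
        have hb : ∀ (w k : ℝ), IntervalIntegrable (fun σ => |rayIntegral S w
            (z n + 1 / (((z n).den : ℝ) ^ 2 * (σ + k))) - rayIntegral S w t₀|) volume
            σ₀ (σ₀ + η) := by
          intro w k
          refine intervalIntegrable_of_abs_le (C := |w| + |w|) ?_ ?_ _ _
          · exact (((measurable_rayIntegral hS w).comp (by fun_prop)).sub_const _).abs
          · intro x
            rw [abs_abs]
            exact (abs_sub _ _).trans
              (add_le_add (rayIntegral_abs_le hS _ _) (rayIntegral_abs_le hS _ _))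
        have hb0 := hb s 0
        simp only [add_zero] at hb0
        rw [← intervalIntegral.integral_comp_add_right (fun σ => |rayIntegral S s'
            (z n + 1 / (((z n).den : ℝ) ^ 2 * σ)) - rayIntegral S s' t₀|),
          ← intervalIntegral.integral_const_mul,
          ← intervalIntegral.integral_add (hb0.const_mul _) (hb s' 1)]
        have e1 : η * D = ∫ _ in σ₀..(σ₀ + η), D := by simp
        have e2 : η * (2 * s * η / σ₀ ^ 2) = ∫ _ in σ₀..(σ₀ + η), (2 * s * η / σ₀ ^ 2 : ℝ) := by
          simp; ring
        rw [e1, e2, ← intervalIntegral.integral_add ((hb0.const_mul _).add (hb s' 1)) (by simp)]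
        refine intervalIntegral.integral_mono_on (by linarith) (by simp)
          (((hb0.const_mul _).add (hb s' 1)).add (by simp)) ?_
        intro σ hσ
        have hσ0 : 0 < σ := hσpos.trans_le hσ.1
        set A := rayIntegral S s (z n + 1 / (((z n).den : ℝ) ^ 2 * σ))
        set B := rayIntegral S s' (z n + 1 / (((z n).den : ℝ) ^ 2 * (σ + 1)))
        have hpar := hinv.rayIntegral_parabolic (z n) hσ0 s
        have hsub := rayIntegral_sub_le hS ((σ + 1) / σ * s) s'
          (z n + 1 / (((z n).den : ℝ) ^ 2 * (σ + 1)))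
        rw [hpar] at hsub
        have hA : |A| ≤ s := by simpa [abs_of_pos hs] using rayIntegral_abs_le hS (s : ℝ) _
        have hs' : (s' : ℝ) = (1 + 1 / σ₀) * s := by rw [← hl]; field_simp
        have hfrac : (σ + 1) / σ = 1 + 1 / σ := by field_simp
        have hdiff0 : 0 ≤ 1 / σ₀ - 1 / σ :=
          sub_nonneg.2 (one_div_le_one_div_of_le hσpos hσ.1)
        have hdiff : 1 / σ₀ - 1 / σ ≤ η / σ₀ ^ 2 := by
          rw [div_sub_div _ _ hσpos.ne' hσ0.ne', div_le_div_iff₀ (by positivity) (by positivity)]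
          have : σ - σ₀ ≤ η := by linarith [hσ.2]
          have h5 : σ₀ * σ₀ ≤ σ₀ * σ := mul_le_mul_of_nonneg_left hσ.1 hσpos.le
          nlinarith [mul_le_mul this h5 (by positivity) hη.le, sq_nonneg σ₀]
        have e3 : |(σ + 1) / σ * s - s'| = (1 / σ₀ - 1 / σ) * s := by
          rw [hfrac, hs', abs_sub_comm, abs_of_nonneg] <;> nlinarith
        have e4 : |(s' / s : ℝ) * A - (σ + 1) / σ * A| ≤ (1 / σ₀ - 1 / σ) * s := by
          rw [hl, hfrac, ← sub_mul, abs_mul, add_sub_add_left_eq_sub, abs_of_nonneg hdiff0]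
          gcongr
        have e5 : (1 / σ₀ - 1 / σ) * s ≤ s * η / σ₀ ^ 2 := by
          rw [mul_div_assoc, mul_comm]; gcongr
        rw [e3] at hsub
        have e6 : |(s' / s : ℝ) * rayIntegral S s t₀ - (s' / s : ℝ) * A| =
            (s' / s : ℝ) * |A - rayIntegral S s t₀| := by
          rw [← mul_sub, abs_mul, abs_of_pos (div_pos (hs.trans hss') hs), abs_sub_comm]
        have t1 := abs_sub_le ((s' / s : ℝ) * rayIntegral S s t₀) ((s' / s : ℝ) * A)
          (rayIntegral S s' t₀)
        have t2 := abs_sub_le ((s' / s : ℝ) * A) ((σ + 1) / σ * A) (rayIntegral S s' t₀)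
        have t3 := abs_sub_le ((σ + 1) / σ * A) B (rayIntegral S s' t₀)
        have e7 : 2 * s * η / σ₀ ^ 2 = s * η / σ₀ ^ 2 + s * η / σ₀ ^ 2 := by ring
        rw [e7]
        linarith
      have h5 := ge_of_tendsto' h3 h4
      rw [mul_zero, add_zero, zero_add] at h5
      exact le_of_mul_le_mul_left h5 hη
    have hD0 : D ≤ 0 := by
      have hlim : Tendsto (fun η : ℝ => 2 * s * η / σ₀ ^ 2) (𝓝[>] 0) (𝓝 0) := by
        have : Tendsto (fun η : ℝ => 2 * s * η / σ₀ ^ 2) (𝓝 0) (𝓝 (2 * s * 0 / σ₀ ^ 2)) :=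
          Continuous.tendsto (by fun_prop) 0
        rw [mul_zero, zero_div] at this
        exact this.mono_left nhdsWithin_le_nhds
      exact ge_of_tendsto hlim (eventually_mem_nhdsWithin.mono fun η hη => hDle η hη)
    exact sub_eq_zero.1 (abs_nonpos_iff.1 hD0)
  have hrat : ∀ s : ℚ, 0 < s → rayIntegral S s t₀ = s * rayIntegral S 1 t₀ := by
    intro s hs
    have hs' : (s : ℝ) ≠ 0 := by exact_mod_cast hs.ne'
    rcases lt_trichotomy s 1 with h | h | h
    · have := key s 1 hs h
      push_cast at this
      rw [← this]; field_simp
    · simp [h]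
    · have := key 1 s one_pos h
      push_cast at this
      rw [← this]; simp
  intro s hs
  have hcont : Continuous fun s => rayIntegral S s t₀ := by
    refine (LipschitzWith.of_dist_le_mul (K := 1) fun a b => ?_).continuous
    simpa [Real.dist_eq] using rayIntegral_sub_le hS a b t₀
  have hcl : IsClosed {s : ℝ | rayIntegral S s t₀ = s * rayIntegral S 1 t₀} :=
    isClosed_eq hcont (by fun_prop)
  have hsub : Ioi (0 : ℝ) ∩ range ((↑) : ℚ → ℝ) ⊆
      {s : ℝ | rayIntegral S s t₀ = s * rayIntegral S 1 t₀} := by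
    rintro _ ⟨h, q, rfl⟩
    exact hrat q (Rat.cast_pos.1 (mem_Ioi.1 h))
  have hdense := (show Dense (range ((↑) : ℚ → ℝ)) from Rat.denseRange_cast).open_subset_closure_inter
    (isOpen_Ioi (a := 0))
  exact closure_minimal hsub hcl (hdense hs)

/-- The height-one integral over the rays is almost everywhere constant. -/
theorem SLInvariant.exists_ae_rayIntegral_eq (hinv : SLInvariant S) (hS : MeasurableSet S) :
    ∃ h : ℝ, ∀ᵐ t : ℝ, rayIntegral S 1 t = h := by
  have hgood := hinv.ae_rayIntegral_eq hS
  obtain ⟨t₀, ht₀, hti⟩ := ((ae_tendsto_integral_approx (measurable_rayIntegral hS 1)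
    (rayIntegral_abs_le hS 1)).and ae_irrational).exists
  obtain ⟨z, hz, hzt⟩ := hti.exists_seq_rat
  set H := rayIntegral S 1 with hH
  have hper : Function.Periodic (fun t => |H t - H t₀|) 1 := fun t => by
    simp only [hH, hinv.rayIntegral_one_periodic t]
  have hlim := ht₀ z hz hzt 1 2 one_pos one_le_two
  have hconst : ∀ n, ∫ σ in (1 : ℝ)..2, |H (z n + 1 / (((z n).den : ℝ) ^ 2 * σ)) - H t₀| =
      ∫ t in (0 : ℝ)..(0 + 1), |H t - H t₀| := by
    intro n
    obtain ⟨u, v, huv⟩ := Rat.isCoprime_num_den (z n)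
    have hq : (0 : ℝ) < (z n).den := by exact_mod_cast (z n).den_pos
    have hzn : ((z n : ℚ) : ℝ) = (z n).num / (z n).den := by
      exact_mod_cast (Rat.num_div_den (z n)).symm
    have huv' : (u : ℝ) * (z n).num + v * (z n).den = 1 := by exact_mod_cast huv
    have hqm : Measure.QuasiMeasurePreserving (fun σ : ℝ => -u / (z n).den - σ) :=
      (Measure.measurePreserving_sub_left volume _).quasiMeasurePreserving
    have h1 : ∫ σ in (1 : ℝ)..2, |H (z n + 1 / (((z n).den : ℝ) ^ 2 * σ)) - H t₀| =
        ∫ σ in (1 : ℝ)..2, |H (-u / (z n).den - σ) - H t₀| := by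
      refine intervalIntegral.integral_congr_ae ?_
      filter_upwards [hqm.ae hgood] with σ hσ hσI
      rw [uIoc_of_le one_le_two] at hσI
      have hσ0 : 0 < σ := one_pos.trans hσI.1
      have hc : 0 < (z n).den * σ := mul_pos hq hσ0
      -- This matrix sends `-u / den - σ` to `z n + 1 / (den² σ)` and multiplies heights by `den *
      -- σ`. Proportionality to height cancels that factor, so `H` has the same value at both
      -- parameters.
      have hm := hinv.rayIntegral_moebius (p := -(z n).num) (q := v) (r := -((z n).den : ℤ))
        (s := -u) (by linarith) (t := -u / (z n).den - σ) (c := (z n).den * σ)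
        (t' := z n + 1 / (((z n).den : ℝ) ^ 2 * σ))
        (by push_cast; field_simp; ring)
        (by
          push_cast; rw [hzn]; field_simp
          linear_combination (-1 : ℝ) * huv') (1 / ((z n).den * σ))
      rw [mul_one_div_cancel hc.ne', hσ _ (by positivity), ← mul_assoc,
        mul_one_div_cancel hc.ne', one_mul] at hm
      rw [hH, hm]
    rw [h1, intervalIntegral.integral_comp_sub_left (fun t => |H t - H t₀|)]
    have := hper.intervalIntegral_add_eq (-u / (z n).den - 2) 0
    rw [← this]
    congr 1
    ring
  -- The integrals tend to zero but, by periodicity, do not depend on `n`. Hence the integral over a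
  -- full period vanishes.
  simp only [hconst] at hlim
  have hzero := tendsto_nhds_unique hlim tendsto_const_nhds
  refine ⟨H t₀, ?_⟩
  have hint : ∀ a b : ℝ, IntervalIntegrable (fun t => |H t - H t₀|) volume a b := by
    refine intervalIntegrable_of_abs_le (C := |1| + |1|)
      ((measurable_rayIntegral hS 1).sub_const _).abs ?_
    intro x
    rw [abs_abs]
    exact (abs_sub _ _).trans (add_le_add (rayIntegral_abs_le hS _ _) (rayIntegral_abs_le hS _ _))
  have hIoc : ∀ k : ℤ, ∀ᵐ t ∂(volume.restrict (Ioc (k : ℝ) (k + 1))), H t = H t₀ := by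
    intro k
    have h1 := (hper.intervalIntegral_add_eq k 0).trans hzero.symm
    rw [intervalIntegral.integral_eq_zero_iff_of_le_of_nonneg_ae (by linarith)
      (Eventually.of_forall fun _ => abs_nonneg _) (hint _ _)] at h1
    filter_upwards [h1] with t ht
    exact sub_eq_zero.1 (abs_eq_zero.1 ht)
  have := (ae_restrict_iUnion_iff _ _).2 hIoc
  rwa [iUnion_Ioc_intCast, Measure.restrict_univ] at this

/-- The linear action of `SL(2, ℤ)` on the upper half plane is ergodic for Lebesgue measure. -/
theorem SLInvariant.ae_mem_or_ae_notMem (hinv : SLInvariant S) (hS : MeasurableSet S) :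
    (∀ᵐ v : ℝ × ℝ, 0 < v.2 → v ∈ S) ∨ ∀ᵐ v : ℝ × ℝ, 0 < v.2 → v ∉ S := by
  obtain ⟨h, hh⟩ := hinv.exists_ae_rayIntegral_eq hS
  have h1 : ∀ᵐ t : ℝ, ∀ᵐ y : ℝ, 0 < y → coneIndicator S t y = h := by
    filter_upwards [hh, hinv.ae_rayIntegral_eq hS] with t ht ht'
    have hloc : LocallyIntegrable (coneIndicator S t) := by
      intro x
      refine ⟨Metric.closedBall x 1, Metric.closedBall_mem_nhds x one_pos, ?_⟩
      exact Measure.integrableOn_of_bounded (M := 1) measure_closedBall_lt_top.ne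
        (measurable_coneIndicator_right hS t).aestronglyMeasurable
        (Eventually.of_forall (coneIndicator_abs_le t))
    -- Differentiating the integral in its upper limit gives the indicator at `y`; differentiating
    -- `s * h` gives `h`. So the indicator is almost everywhere the constant `h`.
    filter_upwards [LocallyIntegrable.ae_hasDerivAt_integral hloc] with y hy hy0
    have h2 : HasDerivAt (fun s => s * h) h y := by simpa using (hasDerivAt_id y).mul_const h
    refine (hy 0).unique (h2.congr_of_eventuallyEq ?_)
    filter_upwards [lt_mem_nhds hy0] with s hs
    rw [← ht]
    exact ht' s hs
  have main : ∀ T : Set (ℝ × ℝ), MeasurableSet T →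
      (∀ᵐ t : ℝ, ∀ᵐ y : ℝ, 0 < y → (t * y, y) ∈ T) → ∀ᵐ v : ℝ × ℝ, 0 < v.2 → v ∈ T := by
    intro T hT h2
    have hm : Measurable fun p : ℝ × ℝ => (p.1 * p.2, p.2) := by fun_prop
    have hpos : MeasurableSet {p : ℝ × ℝ | 0 < p.2} := measurableSet_lt measurable_const
      measurable_snd
    rw [Measure.ae_ae_comm (p := fun t y => 0 < y → (t * y, y) ∈ T) (hpos.imp (hm hT))] at h2
    rw [Measure.volume_eq_prod, Measure.ae_prod_iff_ae_ae (p := fun v => 0 < v.2 → v ∈ T) (hpos.imp hT),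
      Measure.ae_ae_comm (p := fun x y => 0 < y → (x, y) ∈ T) (hpos.imp hT)]
    filter_upwards [h2] with y hy
    by_cases hy0 : 0 < y
    · have hq : Measure.QuasiMeasurePreserving (fun x : ℝ => x * y⁻¹) := by
        refine ⟨by fun_prop, Measure.AbsolutelyContinuous.mk fun s hs h0 => ?_⟩
        rw [Measure.map_apply (by fun_prop) hs,
          Real.volume_preimage_mul_right (inv_ne_zero hy0.ne'), h0, mul_zero]
      filter_upwards [hq.ae hy] with x hx _
      simpa [mul_assoc, inv_mul_cancel₀ hy0.ne'] using hx hy0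
    · exact Eventually.of_forall fun x hx => absurd hx hy0
  by_cases h1h : h = 1
  · left
    refine main S hS ?_
    filter_upwards [h1] with t ht
    filter_upwards [ht] with y hy hy0
    by_contra hn
    have := hy hy0
    rw [coneIndicator, indicator_of_notMem hn, h1h] at this
    exact zero_ne_one this
  · right
    refine main Sᶜ hS.compl ?_
    filter_upwards [h1] with t ht
    filter_upwards [ht] with y hy hy0 hn
    have := hy hy0
    rw [coneIndicator, indicator_of_mem hn] at this
    exact h1h this.symm

end PlaneErgodicity

/-! ### Orbits of `Φ` as `SL(2, ℤ)`-orbits; ergodicity. -/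

namespace BCZ

/-- Two points of the triangle related by a lower triangular element of `SL(2, ℤ)` are equal. -/
theorem eq_of_lower_triangular {v w : Ω} {p r s : ℤ} (hps : p * s = 1)
    (h1 : w.1.1 = p * v.1.1) (h2 : w.1.2 = r * v.1.1 + s * v.1.2) : v = w := by
  obtain ⟨a0, a1, b0, b1, ab⟩ := v.2
  obtain ⟨x0, x1, y0, y1, xy⟩ := w.2
  have hp0 : 0 < p := by
    have : (0 : ℝ) < p * v.1.1 := by rwa [← h1]
    exact_mod_cast pos_of_mul_pos_left this a0.le
  have hp : p = 1 := by
    rcases Int.eq_one_or_neg_one_of_mul_eq_one hps with h | h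
    · exact h
    · omega
  have hs : s = 1 := by rw [hp, one_mul] at hps; exact hps
  subst hp hs
  simp only [Int.cast_one, one_mul] at h1 h2
  have hr : r = 0 := by
    have h3 : (r : ℝ) * v.1.1 < 1 * v.1.1 := by linarith
    have h4 : (-1 : ℝ) * v.1.1 < r * v.1.1 := by linarith
    have h5 : (r : ℝ) < 1 := lt_of_mul_lt_mul_right h3 a0.le
    have h6 : (-1 : ℝ) < r := lt_of_mul_lt_mul_right h4 a0.le
    have h7 : r < 1 := by exact_mod_cast h5
    have h8 : -1 < r := by exact_mod_cast h6
    omega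
  subst hr
  simp only [Int.cast_zero, zero_mul, zero_add] at h2
  exact Subtype.ext (Prod.ext h1.symm h2.symm)

/-- Two points of the triangle related by an element of `SL(2, ℤ)` with nonnegative upper right
entry lie on the same forward orbit of `Φ`. -/
theorem exists_iterate_eq {v w : Ω} {p q r s : ℤ} (hdet : p * s - q * r = 1) (hq : 0 ≤ q)
    (h1 : w.1.1 = p * v.1.1 + q * v.1.2) (h2 : w.1.2 = r * v.1.1 + s * v.1.2) :
    ∃ n, Φ^[n] v = w := by
  -- This quotient plays the part of the flow time from `v` to `w`. Replacing `w` by `Ψ w` lowers it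
  -- by `1 / ((Ψ w).1.1 * w.1.1) ≥ 1`, so the induction descends.
  obtain ⟨N, hN⟩ := exists_nat_ge ((q : ℝ) / (v.1.1 * w.1.1))
  induction N generalizing w p q r s with
  | zero =>
    rcases hq.eq_or_lt with rfl | hq0
    · exact ⟨0, eq_of_lower_triangular (p := p) (by linarith) (by simpa using h1) h2⟩
    have hqR : (1 : ℝ) ≤ q := by exact_mod_cast hq0
    have a0 := v.2.1
    have x0 := w.2.1
    have : 0 < (q : ℝ) / (v.1.1 * w.1.1) := by positivity
    rw [Nat.cast_zero] at hN
    linarith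
  | succ N ih =>
    rcases hq.eq_or_lt with rfl | hq0
    · exact ⟨0, eq_of_lower_triangular (p := p) (by linarith) (by simpa using h1) h2⟩
    have hqR : (1 : ℝ) ≤ q := by exact_mod_cast hq0
    have a0 := v.2.1
    have x0 := w.2.1
    obtain ⟨-, a1, b0, b1, ab⟩ := v.2
    obtain ⟨-, x1, y0, y1, xy⟩ := w.2
    set k : ℤ := ⌊(1 + w.1.2) / w.1.1⌋ with hk
    obtain ⟨x0', x1', -, -, xy'⟩ := (Ψ w).2
    have e1 : (Ψ w).1.2 = w.1.1 := rfl
    have e2 : (Ψ w).1.1 = -w.1.2 + k * w.1.1 := rfl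
    have hdet' : (k * p - r) * q - (k * q - s) * p = 1 := by linarith
    have e3 : (Ψ w).1.1 = ((k * p - r : ℤ) : ℝ) * v.1.1 + ((k * q - s : ℤ) : ℝ) * v.1.2 := by
      rw [e2, h1, h2]; push_cast; ring
    have e4 : (Ψ w).1.2 = p * v.1.1 + q * v.1.2 := by rw [e1, h1]
    have hdetR : ((k * p - r : ℤ) : ℝ) * q - ((k * q - s : ℤ) : ℝ) * p = 1 := by
      exact_mod_cast hdet'
    -- A negative entry would give `v.1.1 ≥ (Ψ w).1.1 + (Ψ w).1.2 > 1`: going back cannot overshoot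
    -- `v`.
    by_cases hneg : k * q - s < 0
    · exfalso
      have h3 : ((k * q - s : ℤ) : ℝ) ≤ -1 := by exact_mod_cast Int.le_sub_one_of_lt hneg
      have h4 : v.1.1 = q * (Ψ w).1.1 - ((k * q - s : ℤ) : ℝ) * (Ψ w).1.2 := by
        rw [e3, e4]; linear_combination (-v.1.1) * hdetR
      rw [e1] at xy' h4
      nlinarith
    · have h3 : (((k * q - s : ℤ) : ℝ)) / (v.1.1 * (Ψ w).1.1) ≤ N := by
        have h4 : (q : ℝ) / (v.1.1 * w.1.1) - ((k * q - s : ℤ) : ℝ) / (v.1.1 * (Ψ w).1.1) =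
            1 / ((Ψ w).1.1 * w.1.1) := by
          have h5 : (q : ℝ) * (Ψ w).1.1 - ((k * q - s : ℤ) : ℝ) * w.1.1 = v.1.1 := by
            rw [e3, ← e1, e4]; linear_combination v.1.1 * hdetR
          rw [← sub_eq_zero]
          field_simp
          linear_combination h5
        have h5 : 1 ≤ 1 / ((Ψ w).1.1 * w.1.1) := by
          rw [le_div_iff₀ (by positivity)]
          nlinarith
        push_cast at hN h4 h5 ⊢
        linarith
      obtain ⟨n, hn⟩ := ih hdet' (not_lt.1 hneg) e3 e4 h3
      exact ⟨n + 1, by rw [Function.iterate_succ_apply', hn, Φ_Ψ]⟩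

/-- The saturation of a subset of the triangle under the action of `SL(2, ℤ)`. -/
def saturation (A : Set Ω) : Set (ℝ × ℝ) :=
  {v | ∃ p q r s : ℤ, p * s - q * r = 1 ∧
    ((p * v.1 + q * v.2 : ℝ), (r * v.1 + s * v.2 : ℝ)) ∈ Subtype.val '' A}

theorem slInvariant_saturation (A : Set Ω) : SLInvariant (saturation A) := by
  intro p q r s h x y
  have hR : (p * s - q * r : ℝ) = 1 := by exact_mod_cast h
  constructor
  · rintro ⟨p', q', r', s', h', hA⟩
    refine ⟨p' * p + q' * r, p' * q + q' * s, r' * p + s' * r, r' * q + s' * s, ?_, ?_⟩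
    · linear_combination h + (p * s - q * r) * h'
    · convert hA using 2 <;> push_cast <;> ring
  · rintro ⟨p', q', r', s', h', hA⟩
    refine ⟨p' * s - q' * r, -p' * q + q' * p, r' * s - s' * r, -r' * q + s' * p, ?_, ?_⟩
    · linear_combination h + (p * s - q * r) * h'
    · convert hA using 2 <;> push_cast
      · linear_combination (p' * x + q' * y) * hR
      · linear_combination (r' * x + s' * y) * hR

theorem measurableSet_saturation {A : Set Ω} (hA : MeasurableSet A) :
    MeasurableSet (saturation A) := by
  have h : saturation A = ⋃ (p : ℤ) (q : ℤ) (r : ℤ) (s : ℤ) (_ : p * s - q * r = 1),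
      (fun v : ℝ × ℝ => ((p * v.1 + q * v.2 : ℝ), (r * v.1 + s * v.2 : ℝ))) ⁻¹'
        (Subtype.val '' A) := by
    ext v
    simp only [saturation, Set.mem_ofPred_eq, Set.mem_iUnion, Set.mem_preimage, exists_prop]
  rw [h]
  have hA' : MeasurableSet (Subtype.val '' A) := measurableSet_Ω.subtype_image hA
  exact .iUnion fun p => .iUnion fun q => .iUnion fun r => .iUnion fun s => .iUnion fun _ =>
    (by fun_prop : Measurable fun v : ℝ × ℝ =>
      ((p * v.1 + q * v.2 : ℝ), (r * v.1 + s * v.2 : ℝ))) hA'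

theorem mem_iff_iterate_mem {A : Set Ω} (hA : Φ ⁻¹' A = A) (n : ℕ) (v : Ω) :
    Φ^[n] v ∈ A ↔ v ∈ A := by
  induction n with
  | zero => rfl
  | succ n ih => rw [Function.iterate_succ_apply', ← ih]; exact (Set.ext_iff.1 hA _)

/-- The saturation of a `Φ`-invariant set meets the triangle in the set itself. -/
theorem mem_saturation_iff {A : Set Ω} (hA : Φ ⁻¹' A = A) (v : Ω) :
    v.1 ∈ saturation A ↔ v ∈ A := by
  constructor
  · rintro ⟨p, q, r, s, h, w, hw, hvw⟩
    have h1 : w.1.1 = p * v.1.1 + q * v.1.2 := by rw [hvw]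
    have h2 : w.1.2 = r * v.1.1 + s * v.1.2 := by rw [hvw]
    rcases le_total 0 q with hq | hq
    · obtain ⟨n, rfl⟩ := exists_iterate_eq h hq h1 h2
      exact (mem_iff_iterate_mem hA n v).1 hw
    · have hR : (p * s - q * r : ℝ) = 1 := by exact_mod_cast h
      -- The inverse matrix has nonnegative upper right entry, so `v` lies on the forward orbit of
      -- `w`.
      obtain ⟨n, rfl⟩ := exists_iterate_eq (v := w) (w := v) (p := s) (q := -q) (r := -r) (s := p)
        (by linarith) (by linarith)
        (by rw [h1, h2]; push_cast; linear_combination (-v.1.1) * hR)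
        (by rw [h1, h2]; push_cast; linear_combination (-v.1.2) * hR)
      exact (mem_iff_iterate_mem hA n w).2 hw
  · intro hv
    exact ⟨1, 0, 0, 1, by norm_num, v, hv, by simp⟩

theorem ergodic_Φ : Ergodic Φ m := by
  refine ⟨measurePreserving_Φ, ⟨fun A hA hinv => ?_⟩⟩
  have key : ∀ T : Set (ℝ × ℝ), (∀ᵐ v : ℝ × ℝ, 0 < v.2 → v ∈ T) → ∀ᵐ v ∂m, v.1 ∈ T := by
    intro T hT
    rw [ae_m_iff]
    have h1 : ∀ᵐ v ∂(volume.restrict Ω), 0 < v.2 → v ∈ T := ae_restrict_of_ae hT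
    filter_upwards [measurePreserving_val.quasiMeasurePreserving.ae h1] with v hv
    exact hv v.2.2.2.1
  rw [Filter.eventuallyConst_set]
  rcases (slInvariant_saturation A).ae_mem_or_ae_notMem (measurableSet_saturation hA) with h | h
  · left
    filter_upwards [key _ h] with v hv
    exact (mem_saturation_iff hinv v).1 hv
  · right
    filter_upwards [key (saturation A)ᶜ h] with v hv hvA
    exact hv ((mem_saturation_iff hinv v).2 hvA)

end BCZ

/-! ### Flow time and non-return to the strip. -/

namespace BCZ
open Filter Topology Set

/-- The return time of the horocycle flow to the triangle. -/
noncomputable def roof (v : Ω) : ℝ := 1 / (v.1.1 * v.1.2)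

/-- The flow time of the first `n` steps of `Φ`. -/
noncomputable def flowTime (v : Ω) (n : ℕ) : ℝ := ∑ i ∈ Finset.range n, roof (Φ^[i] v)

theorem one_le_roof (v : Ω) : 1 ≤ roof v := by
  obtain ⟨h1, h2, h3, h4, -⟩ := v.2
  rw [roof, le_div_iff₀ (by positivity)]
  nlinarith

theorem roof_swap (v : Ω) : roof (swap v) = roof v := by simp [roof, mul_comm]

theorem measurable_roof : Measurable roof := by
  unfold roof
  fun_prop

theorem measurable_flowTime (n : ℕ) : Measurable fun v => flowTime v n := by
  unfold flowTime
  exact Finset.measurable_sum _ fun i _ => measurable_roof.comp (measurable_Φ.iterate i)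

theorem flowTime_succ (v : Ω) (n : ℕ) : flowTime v (n + 1) = flowTime v n + roof (Φ^[n] v) :=
  Finset.sum_range_succ _ _

theorem flowTime_mono (v : Ω) : Monotone (flowTime v) :=
  monotone_nat_of_le_succ fun n => by
    rw [flowTime_succ]; linarith [one_le_roof (Φ^[n] v)]

theorem le_flowTime (v : Ω) (n : ℕ) : (n : ℝ) ≤ flowTime v n := by
  induction n with
  | zero => simp [flowTime]
  | succ n ih => rw [flowTime_succ]; push_cast; linarith [one_le_roof (Φ^[n] v)]

/-- The orbit consists of values of a basis of `ℤ²`, whose slopes are the flow times. -/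
theorem exists_int_coords (v : Ω) (j : ℕ) : ∃ p q r s : ℤ, p * s - q * r = 1 ∧
    (Φ^[j] v).1.1 = p * v.1.1 + q * v.1.2 ∧ (Φ^[j] v).1.2 = r * v.1.1 + s * v.1.2 ∧
    flowTime v j * (v.1.1 * (Φ^[j] v).1.1) = q := by
  induction j with
  | zero => exact ⟨1, 0, 0, 1, by norm_num, by simp, by simp, by simp [flowTime]⟩
  | succ j ih =>
    obtain ⟨p, q, r, s, hdet, h1, h2, h3⟩ := ih
    rw [flowTime_succ]
    simp only [Function.iterate_succ_apply']
    set w := Φ^[j] v with hw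
    have hx := w.2.1.ne'
    have hy := w.2.2.2.1.ne'
    have hR : (p * s - q * r : ℝ) = 1 := by exact_mod_cast hdet
    refine ⟨r, s, -p + ⌊(1 + w.1.1) / w.1.2⌋ * r, -q + ⌊(1 + w.1.1) / w.1.2⌋ * s, ?_, ?_, ?_, ?_⟩
    · linear_combination hdet
    · rw [Φ_fst, h2]
    · rw [Φ_snd]; push_cast
      linear_combination (-1 : ℝ) * h1 + (⌊(1 + w.1.1) / w.1.2⌋ : ℝ) * h2
    · rw [Φ_fst]
      have h4 : roof w * (w.1.1 * w.1.2) = 1 := by rw [roof]; field_simp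
      apply mul_left_cancel₀ hx
      linear_combination w.1.2 * h3 + v.1.1 * h4 + (s : ℝ) * (-h1) + (q : ℝ) * h2 - v.1.1 * hR

/-- The points `(a, b)` with `a` in `(1 - ε, 1]` for which no nonzero combination `p a + q b` with
`0 < q ≤ N` is smaller than `ε`. -/
def base (N : ℕ) (ε : ℝ) : Set (ℝ × ℝ) :=
  {v | 1 - ε < v.1 ∧ v.1 ≤ 1 ∧ v.1 / 4 ≤ v.2 ∧ v.2 ≤ 3 * v.1 / 4 ∧
    ∀ q : ℕ, 1 ≤ q → q ≤ N → ∀ p : ℤ, ε ≤ |p * v.1 + q * v.2|}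

theorem measurableSet_base (N : ℕ) (ε : ℝ) : MeasurableSet (base N ε) := by
  have h : base N ε = {v : ℝ × ℝ | 1 - ε < v.1} ∩ {v | v.1 ≤ 1} ∩ {v | v.1 / 4 ≤ v.2} ∩
      {v | v.2 ≤ 3 * v.1 / 4} ∩ ⋂ (q : ℕ) (_ : 1 ≤ q) (_ : q ≤ N) (p : ℤ),
        {v | ε ≤ |p * v.1 + q * v.2|} := by
    ext v
    simp [base, and_assoc]
  rw [h]
  refine ((((measurableSet_lt ?_ ?_).inter (measurableSet_le ?_ ?_)).inter
    (measurableSet_le ?_ ?_)).inter (measurableSet_le ?_ ?_)).inter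
    (.iInter fun q => .iInter fun _ => .iInter fun _ => .iInter fun p =>
      measurableSet_le measurable_const (Measurable.abs (by fun_prop))) <;> fun_prop

theorem base_subset {N : ℕ} {ε : ℝ} (hε : ε ≤ 1 / 5) : base N ε ⊆ Ω := by
  rintro v ⟨h1, h2, h3, h4, -⟩
  refine ⟨?_, ?_, ?_, ?_, ?_⟩ <;> linarith

/-- Until flow time `N`, an orbit starting in the base does not return to the strip. -/
theorem fst_le_of_flowTime_le {N : ℕ} {ε : ℝ} {v : Ω} (hv : v.1 ∈ base N ε) {j : ℕ} (hj : 1 ≤ j)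
    (hT : flowTime v j ≤ N) : (Φ^[j] v).1.1 ≤ 1 - ε := by
  obtain ⟨p, q, r, s, -, h1, -, h3⟩ := exists_int_coords v j
  by_contra hlt
  rw [not_le] at hlt
  obtain ⟨b1, b2, -, -, b5⟩ := hv
  obtain ⟨x0, x1, -⟩ := (Φ^[j] v).2
  have a0 := v.2.1
  have hT1 : 1 ≤ flowTime v j := le_trans (by exact_mod_cast hj) (le_flowTime v j)
  have hq0 : (0 : ℝ) < q := by rw [← h3]; positivity
  have hqN : (q : ℝ) ≤ N := by
    rw [← h3]
    have : v.1.1 * (Φ^[j] v).1.1 ≤ 1 := by nlinarith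
    nlinarith
  have hq0' : 0 < q := by exact_mod_cast hq0
  lift q to ℕ using hq0'.le
  -- With `p - 1`, the combination is the difference of the two first coordinates, both of which lie
  -- in `(1 - ε, 1]`.
  have h6 := b5 q (by exact_mod_cast hq0') (by exact_mod_cast hqN) (p - 1)
  have h7 : ((p - 1 : ℤ) : ℝ) * v.1.1 + (q : ℝ) * v.1.2 = (Φ^[j] v).1.1 - v.1.1 := by
    rw [h1]; push_cast; ring
  rw [h7, le_abs] at h6
  rcases h6 with h6 | h6 <;> linarith

/-! ### An eigenfunction compared with its dilate. -/

/-- The extension of a function on the triangle by zero. -/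
noncomputable def zeroExtend (f : Ω → ℂ) : ℝ × ℝ → ℂ := Function.extend Subtype.val f 0

theorem zeroExtend_coe (f : Ω → ℂ) (v : Ω) : zeroExtend f v.1 = f v :=
  Subtype.val_injective.extend_apply _ _ _

theorem zeroExtend_of_mem (f : Ω → ℂ) {x : ℝ × ℝ} (hx : x ∈ Ω) : zeroExtend f x = f ⟨x, hx⟩ :=
  zeroExtend_coe f ⟨x, hx⟩

theorem zeroExtend_of_notMem (f : Ω → ℂ) {x : ℝ × ℝ} (hx : x ∉ Ω) : zeroExtend f x = 0 :=
  Function.extend_apply' _ _ _ (by rintro ⟨v, rfl⟩; exact hx v.2)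

theorem measurable_zeroExtend {f : Ω → ℂ} (hf : Measurable f) : Measurable (zeroExtend f) :=
  (MeasurableEmbedding.subtype_coe measurableSet_Ω).measurable_extend hf measurable_const

theorem zeroExtend_comp_swap (f : Ω → ℂ) (x : ℝ × ℝ) :
    zeroExtend (f ∘ swap) x = zeroExtend f x.swap := by
  by_cases hx : x ∈ Ω
  · rw [zeroExtend_of_mem _ hx]
    exact (zeroExtend_coe f (swap ⟨x, hx⟩)).symm
  · rw [zeroExtend_of_notMem _ hx, zeroExtend_of_notMem]
    intro h
    exact hx (swap ⟨_, h⟩).2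

/-- The truncated difference of `f` and its dilation by `L`. -/
noncomputable def defect (f : Ω → ℂ) (L : ℝ) (x : ℝ × ℝ) : ℝ :=
  min 1 ‖zeroExtend f (L⁻¹ • x) - zeroExtend f x‖

theorem defect_nonneg (f : Ω → ℂ) (L : ℝ) (x : ℝ × ℝ) : 0 ≤ defect f L x :=
  le_min zero_le_one (norm_nonneg _)

theorem measurable_defect {f : Ω → ℂ} (hf : Measurable f) (L : ℝ) : Measurable (defect f L) := by
  have h := measurable_zeroExtend hf
  unfold defect
  exact measurable_const.min ((h.comp (by fun_prop)).sub h).norm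

theorem defect_comp_swap (f : Ω → ℂ) (L : ℝ) (v : Ω) :
    defect (f ∘ swap) L v.1 = defect f L (swap v).1 := by
  simp only [defect, zeroExtend_comp_swap]; rfl

theorem smul_mem_iff {L : ℝ} (h0 : 0 < L) (h1 : L ≤ 1) (v : Ω) :
    L⁻¹ • v.1 ∈ Ω ↔ v.1.1 ≤ L ∧ v.1.2 ≤ L := by
  obtain ⟨a0, a1, b0, b1, ab⟩ := v.2
  have e1 : (L⁻¹ • v.1).1 = v.1.1 / L := by simp [div_eq_inv_mul]
  have e2 : (L⁻¹ • v.1).2 = v.1.2 / L := by simp [div_eq_inv_mul]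
  constructor
  · rintro ⟨-, h2, -, h4, -⟩
    rw [e1, div_le_one h0] at h2
    rw [e2, div_le_one h0] at h4
    exact ⟨h2, h4⟩
  · rintro ⟨h2, h4⟩
    refine ⟨?_, ?_, ?_, ?_, ?_⟩
    · rw [e1]; positivity
    · rwa [e1, div_le_one h0]
    · rw [e2]; positivity
    · rwa [e2, div_le_one h0]
    · rw [e1, e2, ← add_div, lt_div_iff₀ h0]; linarith

section Eigenfunction

variable {f : Ω → ℂ} {c : ℂ}

theorem norm_iterate (hf : ∀ v, f (Φ v) = c * f v) (hc : ‖c‖ = 1) (v : Ω) (j : ℕ) :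
    ‖f (Φ^[j] v)‖ = ‖f v‖ := by
  induction j with
  | zero => rfl
  | succ j ih => rw [Function.iterate_succ_apply', hf, norm_mul, hc, one_mul, ih]

theorem defect_eq_one {L : ℝ} {v : Ω} (hv : ‖f v‖ = 1) (h : L⁻¹ • v.1 ∉ Ω) :
    defect f L v.1 = 1 := by
  rw [defect, zeroExtend_of_notMem _ h, zeroExtend_coe, zero_sub, norm_neg, hv, min_self]

/-- For a fixed integer `k` the step is linear, and its value is characterized by lying in the
triangle. So `Φ` commutes with the dilation when both dilated points remain in `Ω`. -/
theorem zeroExtend_smul_Φ (hf : ∀ v, f (Φ v) = c * f v) {L : ℝ} {v : Ω} (h : L⁻¹ • v.1 ∈ Ω)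
    (h' : L⁻¹ • (Φ v).1 ∈ Ω) :
    zeroExtend f (L⁻¹ • (Φ v).1) = c * zeroExtend f (L⁻¹ • v.1) := by
  rw [zeroExtend_of_mem _ h, zeroExtend_of_mem _ h', ← hf]
  congr 1
  symm
  apply Φ_eq ⌊(1 + v.1.1) / v.1.2⌋
  · simp
  · simp only [Prod.smul_snd, Prod.smul_fst, smul_eq_mul, Φ_snd]; ring

/-- The defect does not drop below its first value along the orbit until flow time `N`. -/
theorem defect_le_defect_iterate (hf : ∀ v, f (Φ v) = c * f v) (hc : ‖c‖ = 1) {N : ℕ} {ε : ℝ}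
    (hε0 : 0 < ε) (hε : ε ≤ 1 / 5) {v : Ω} (hv : v.1 ∈ base N ε) (hfv : ‖f v‖ = 1) {j : ℕ}
    (hj : 1 ≤ j) (hT : flowTime v j ≤ N) :
    defect f (1 - ε) (Φ v).1 ≤ defect f (1 - ε) (Φ^[j] v).1 := by
  set L := 1 - ε with hL
  have hL0 : 0 < L := by linarith
  have hL1 : L ≤ 1 := by linarith
  -- Outside the dilated triangle the zero extension makes the defect 1, its largest possible value.
  by_cases hjΩ : L⁻¹ • (Φ^[j] v).1 ∈ Ω
  swap
  · rw [defect_eq_one ((norm_iterate hf hc v j).trans hfv) hjΩ]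
    exact min_le_left _ _
  have hmem : ∀ i, 1 ≤ i → i ≤ j → L⁻¹ • (Φ^[i] v).1 ∈ Ω := by
    intro i h1 hij
    rcases hij.eq_or_lt with rfl | hlt
    · exact hjΩ
    rw [smul_mem_iff hL0 hL1]
    refine ⟨fst_le_of_flowTime_le hv h1 ((flowTime_mono v hij).trans hT), ?_⟩
    -- The second coordinate is the first coordinate of the next point. This needs `i < j`; at `i =
    -- j` membership is the case assumption.
    have := fst_le_of_flowTime_le hv (j := i + 1) (by omega) ((flowTime_mono v hlt).trans hT)
    rwa [Function.iterate_succ_apply', Φ_fst] at this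
  have hnorm : ∀ i, 1 ≤ i → i ≤ j →
      ‖zeroExtend f (L⁻¹ • (Φ^[i] v).1) - zeroExtend f (Φ^[i] v).1‖ =
      ‖zeroExtend f (L⁻¹ • (Φ v).1) - zeroExtend f (Φ v).1‖ := by
    intro i h1
    induction i, h1 using Nat.le_induction with
    | base => intro _; rfl
    | succ i h1 ih =>
      intro hij
      have h2 := hmem (i + 1) (by omega) hij
      rw [← ih (by omega)]
      rw [Function.iterate_succ_apply'] at h2 ⊢
      rw [zeroExtend_smul_Φ hf (hmem i h1 (by omega)) h2, zeroExtend_coe, zeroExtend_coe, hf,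
        ← mul_sub, norm_mul, hc, one_mul]
  exact le_of_eq (by rw [defect, defect, hnorm j hj le_rfl])

/-- The sum of the defects along an orbit starting in the base. -/
theorem defect_mul_le_tsum (hf : ∀ v, f (Φ v) = c * f v) (hc : ‖c‖ = 1) {N : ℕ} (hN : 13 ≤ N)
    {ε : ℝ} (hε0 : 0 < ε) (hε : ε ≤ 1 / 5) {v : Ω} (hv : v.1 ∈ base N ε) (hfv : ‖f v‖ = 1) :
    ENNReal.ofReal (N / 2) * ENNReal.ofReal (defect f (1 - ε) (Φ v).1) ≤
      ∑' j : ℕ, {w | w.1 ∈ base N ε ∧ flowTime w (j + 1) ≤ N}.indicator (fun w =>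
        ENNReal.ofReal (defect f (1 - ε) (Φ^[j + 1] w).1 * roof (Φ^[j + 1] w))) v := by
  have hT1 : flowTime v 1 ≤ N / 2 := by
    obtain ⟨b1, b2, b3, b4, -⟩ := hv
    have hN' : (13 : ℝ) ≤ N := by exact_mod_cast hN
    -- On the base `a ≥ 4 / 5` and `b ≥ a / 4`, so the first step takes time at most `25 / 4`. The
    -- bound `13 ≤ N` makes this at most `N / 2`, leaving at least `N / 2` for the later steps.
    have : 4 / 25 ≤ v.1.1 * v.1.2 := by nlinarith
    have h2 : roof v ≤ 1 / (4 / 25) := one_div_le_one_div_of_le (by norm_num) this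
    simp only [flowTime, Finset.range_one, Finset.sum_singleton, Function.iterate_zero, id]
    linarith
  have hex : ∃ n : ℕ, (N : ℝ) < flowTime v (n + 1) :=
    ⟨N, lt_of_lt_of_le (by push_cast; linarith) (le_flowTime v (N + 1))⟩
  classical
  set J := Nat.find hex with hJ
  have hJ1 := Nat.find_spec hex
  rw [← hJ] at hJ1
  have hlt : ∀ j < J, flowTime v (j + 1) ≤ N := fun j hj => not_lt.1 (Nat.find_min hex hj)
  set d := defect f (1 - ε) (Φ v).1 with hd
  have hd0 : 0 ≤ d := defect_nonneg _ _ _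
  have hsum : flowTime v (J + 1) = ∑ j ∈ Finset.range J, roof (Φ^[j + 1] v) + flowTime v 1 := by
    rw [flowTime, Finset.sum_range_succ']
    simp [flowTime]
  calc ENNReal.ofReal (N / 2) * ENNReal.ofReal d
      ≤ ENNReal.ofReal (∑ j ∈ Finset.range J, d * roof (Φ^[j + 1] v)) := by
        rw [← ENNReal.ofReal_mul (by positivity), ← Finset.mul_sum, mul_comm]
        apply ENNReal.ofReal_le_ofReal
        gcongr
        linarith
    _ = ∑ j ∈ Finset.range J, ENNReal.ofReal (d * roof (Φ^[j + 1] v)) :=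
        ENNReal.ofReal_sum_of_nonneg fun j _ =>
          mul_nonneg hd0 (zero_le_one.trans (one_le_roof _))
    _ ≤ ∑ j ∈ Finset.range J, {w | w.1 ∈ base N ε ∧ flowTime w (j + 1) ≤ N}.indicator (fun w =>
        ENNReal.ofReal (defect f (1 - ε) (Φ^[j + 1] w).1 * roof (Φ^[j + 1] w))) v := by
        refine Finset.sum_le_sum fun j hj => ?_
        have hT := hlt j (Finset.mem_range.1 hj)
        rw [indicator_of_mem (show v ∈ {w : Ω | w.1 ∈ base N ε ∧ flowTime w (j + 1) ≤ N} from
          ⟨hv, hT⟩)]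
        apply ENNReal.ofReal_le_ofReal
        exact mul_le_mul_of_nonneg_right
          (defect_le_defect_iterate hf hc hε0 hε hv hfv (by omega) hT)
          (zero_le_one.trans (one_le_roof _))
    _ ≤ _ := ENNReal.sum_le_tsum _

theorem iterate_Φ_iterate_Ψ (n : ℕ) (v : Ω) : Φ^[n] (Ψ^[n] v) = v :=
  (Function.LeftInverse.iterate (fun v => Φ_Ψ v) n) v

/-- The tower over the base, up to flow time `N`, embeds in the space. -/
theorem setLIntegral_tsum_le {N : ℕ} {ε : ℝ} {G : Ω → ENNReal} (hG : Measurable G) :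
    ∫⁻ v in Subtype.val ⁻¹' base N ε,
      (∑' j : ℕ, {w : Ω | w.1 ∈ base N ε ∧ flowTime w (j + 1) ≤ N}.indicator
        (fun w => G (Φ^[j + 1] w)) v) ∂vol ≤ ∫⁻ v, G v ∂vol := by
  set A : ℕ → Set Ω := fun j => {w | w.1 ∈ base N ε ∧ flowTime w (j + 1) ≤ N} with hA
  have hAm : ∀ j, MeasurableSet (A j) := fun j =>
    (measurable_subtype_coe (measurableSet_base N ε)).inter
      (measurableSet_le (measurable_flowTime (j + 1)) measurable_const)
  have hGm : ∀ j, Measurable ((A j).indicator fun w => G (Φ^[j + 1] w)) := fun j =>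
    (hG.comp (measurable_Φ.iterate _)).indicator (hAm j)
  have hΨ : ∀ j, MeasurePreserving (Ψ^[j + 1]) vol vol := fun j => measurePreserving_Ψ.iterate _
  calc _ ≤ ∫⁻ v, (∑' j : ℕ, (A j).indicator (fun w => G (Φ^[j + 1] w)) v) ∂vol :=
        setLIntegral_le_lintegral _ _
    _ = ∑' j : ℕ, ∫⁻ v, (A j).indicator (fun w => G (Φ^[j + 1] w)) v ∂vol :=
        lintegral_tsum fun j => (hGm j).aemeasurable
    _ = ∑' j : ℕ, ∫⁻ v in Ψ^[j + 1] ⁻¹' A j, G v ∂vol := by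
        congr 1
        ext1 j
        rw [← (hΨ j).lintegral_comp (hGm j), ← lintegral_indicator ((hΨ j).measurable (hAm j))]
        congr 1
        ext1 v
        by_cases h : Ψ^[j + 1] v ∈ A j
        · rw [indicator_of_mem h, indicator_of_mem (mem_preimage.2 h), iterate_Φ_iterate_Ψ]
        · rw [indicator_of_notMem h, indicator_of_notMem (fun h' => h (mem_preimage.1 h'))]
    _ = ∫⁻ v in ⋃ j, Ψ^[j + 1] ⁻¹' A j, G v ∂vol := by
        rw [lintegral_iUnion (fun j => (hΨ j).measurable (hAm j))]
        -- A common point of two levels would give a base point that returns to the strip after `j -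
        -- i` steps, within flow time `N`.
        have hlt : ∀ i j : ℕ, i < j → Disjoint (Ψ^[i + 1] ⁻¹' A i) (Ψ^[j + 1] ⁻¹' A j) := by
          intro i j hij
          refine Set.disjoint_left.2 fun v hi hj => ?_
          have h1 : Φ^[j - i] (Ψ^[j + 1] v) = Ψ^[i + 1] v := by
            have : j + 1 = (j - i) + (i + 1) := by omega
            rw [this, Function.iterate_add_apply Ψ, iterate_Φ_iterate_Ψ]
          have h2 := fst_le_of_flowTime_le hj.1 (j := j - i) (by omega)
            ((flowTime_mono _ (by omega)).trans hj.2)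
          rw [h1] at h2
          exact absurd hi.1.1 (not_lt.2 h2)
        intro i j hij
        rcases lt_or_gt_of_ne hij with h | h
        · exact hlt i j h
        · exact (hlt j i h).symm
    _ ≤ _ := setLIntegral_le_lintegral _ _

theorem setLIntegral_defect_le (hfm : Measurable f) (hf : ∀ v, f (Φ v) = c * f v) (hc : ‖c‖ = 1)
    (hf1 : ∀ᵐ v ∂vol, ‖f v‖ = 1) {N : ℕ} (hN : 13 ≤ N) {ε : ℝ} (hε0 : 0 < ε) (hε : ε ≤ 1 / 5) :
    ENNReal.ofReal (N / 2) * ∫⁻ v in Subtype.val ⁻¹' base N ε,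
      ENNReal.ofReal (defect f (1 - ε) (Φ v).1) ∂vol ≤
    ∫⁻ v, ENNReal.ofReal (defect f (1 - ε) v.1 * roof v) ∂vol := by
  have hdm := measurable_defect hfm (1 - ε)
  have hG : Measurable fun v : Ω => ENNReal.ofReal (defect f (1 - ε) v.1 * roof v) :=
    ((hdm.comp measurable_subtype_coe).mul measurable_roof).ennreal_ofReal
  refine le_trans ?_ (setLIntegral_tsum_le (N := N) (ε := ε) hG)
  rw [← lintegral_const_mul' _ _ ENNReal.ofReal_ne_top]
  refine lintegral_mono_ae ?_
  have hE : MeasurableSet (Subtype.val ⁻¹' base N ε : Set Ω) :=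
    measurable_subtype_coe (measurableSet_base N ε)
  filter_upwards [ae_restrict_of_ae hf1, ae_restrict_mem hE] with v h1 h2
  exact defect_mul_le_tsum hf hc hN hε0 hε h2 h1

theorem Φ_swap_of_mem_base {N : ℕ} {ε : ℝ} (hε : ε ≤ 1 / 5) {v : Ω} (hv : v.1 ∈ base N ε) :
    (Φ (swap v)).1 = (v.1.1, v.1.1 - v.1.2) := by
  obtain ⟨b1, b2, b3, b4, -⟩ := hv
  have hk := floor_eq (p := swap v) (y := v.1.1 - v.1.2) (k := 1) (by simp; ring)
    (by linarith) (by simp; linarith)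
  ext
  · rfl
  · rw [Φ_snd, hk]; simp; ring

/-- The reflection `b ↦ a - b` exchanges the bounds `a / 4` and `3 a / 4` and permutes the integral
combinations up to sign. It is the time reversal of the base. -/
theorem Φ_swap_mem_base {N : ℕ} {ε : ℝ} (hε : ε ≤ 1 / 5) {v : Ω} (hv : v.1 ∈ base N ε) :
    (Φ (swap v)).1 ∈ base N ε := by
  rw [Φ_swap_of_mem_base hε hv]
  obtain ⟨b1, b2, b3, b4, b5⟩ := hv
  refine ⟨b1, b2, by dsimp only; linarith, by dsimp only; linarith, fun q h1 h2 p => ?_⟩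
  have := b5 q h1 h2 (-p - q)
  rw [← abs_neg] at this
  convert this using 2
  push_cast; ring

/-- Crossing the strip changes the ratio of `f` and its dilation by the factor `c`. -/
theorem min_le_defect_add_defect (hf : ∀ v, f (Φ v) = c * f v) (hc : ‖c‖ = 1) {N : ℕ} {ε : ℝ}
    (hε0 : 0 < ε) (hε : ε ≤ 1 / 5) {v : Ω} (hv : v.1 ∈ base N ε) (hfv : ‖f v‖ = 1) :
    min 1 ‖c - 1‖ ≤ defect f (1 - ε) (Φ v).1 + defect f (1 - ε) (Ψ (Ψ v)).1 := by
  set L := 1 - ε with hL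
  have hL0 : 0 < L := by linarith
  have hL1 : L ≤ 1 := by linarith
  set w := Ψ (Ψ v) with hw
  have hΦw : Φ w = Ψ v := Φ_Ψ _
  have hΦΦw : Φ (Φ w) = v := by rw [hΦw, Φ_Ψ]
  have hfw : ‖f w‖ = 1 := by
    rw [← norm_iterate hf hc w 2, ← hfv]
    simp only [Function.iterate_succ_apply, Function.iterate_zero_apply, hΦΦw]
  by_cases h1 : L⁻¹ • (Φ v).1 ∈ Ω
  swap
  · rw [defect_eq_one (v := Φ v) ((norm_iterate hf hc v 1).trans hfv) h1]
    linarith [min_le_left 1 ‖c - 1‖, defect_nonneg f L w.1]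
  by_cases h2 : L⁻¹ • w.1 ∈ Ω
  swap
  · rw [defect_eq_one hfw h2]
    linarith [min_le_left 1 ‖c - 1‖, defect_nonneg f L (Φ v).1]
  have hΨv : (Ψ v).1 = (v.1.1 - v.1.2, v.1.1) := by
    exact Prod.ext (congrArg Prod.snd (Φ_swap_of_mem_base hε hv)) rfl
  obtain ⟨b1, b2, b3, b4, -⟩ := hv
  -- In the dilated orbit the entry `a / L > 1` is too large and drops out, so its neighbours `(a -
  -- b) / L` and `b / L` become consecutive; their sum exceeds one precisely because `a > L`.
  have hu : ((v.1.1 - v.1.2) / L, v.1.2 / L) ∈ Ω := by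
    refine ⟨div_pos (by linarith) hL0, (div_le_one hL0).2 (by linarith),
      div_pos (by linarith) hL0, (div_le_one hL0).2 (by linarith), ?_⟩
    dsimp only
    rw [← add_div, sub_add_cancel, one_lt_div hL0]
    exact b1
  have hw2 : w.1.2 = v.1.1 - v.1.2 := by rw [← Φ_fst, hΦw, hΨv]
  have hw1 : v.1.1 = -w.1.1 + (⌊(1 + w.1.1) / w.1.2⌋ : ℝ) * w.1.2 := by rw [← Φ_snd, hΦw, hΨv]
  have e1 : Φ ⟨_, h2⟩ = ⟨_, hu⟩ := by
    apply Φ_eq (⌊(1 + w.1.1) / w.1.2⌋ - 1)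
    · simp only [Prod.smul_snd, smul_eq_mul, hw2]; field_simp
    · simp only [Prod.smul_snd, Prod.smul_fst, smul_eq_mul]
      push_cast
      field_simp
      linear_combination hw1 + hw2
  have e2 : Φ ⟨_, hu⟩ = ⟨_, h1⟩ := by
    apply Φ_eq (⌊(1 + v.1.1) / v.1.2⌋ - 1)
    · simp only [Prod.smul_fst, smul_eq_mul, Φ_fst]; field_simp
    · simp only [Prod.smul_snd, smul_eq_mul, Φ_snd]
      push_cast
      field_simp
      ring
  have e3 : zeroExtend f (L⁻¹ • (Φ v).1) = c ^ 2 * zeroExtend f (L⁻¹ • w.1) := by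
    rw [zeroExtend_of_mem _ h1, zeroExtend_of_mem _ h2, ← e2, hf, ← e1, hf]; ring
  -- Three steps lead from `w` to `Φ v`, but only two between their dilates.
  have e4 : f (Φ v) = c ^ 3 * f w := by
    rw [hf, ← hΦΦw, hf, hf]; ring
  have e5 : ‖c - 1‖ ≤ ‖zeroExtend f (L⁻¹ • (Φ v).1) - f (Φ v)‖ +
      ‖zeroExtend f (L⁻¹ • w.1) - f w‖ := by
    set u := zeroExtend f (L⁻¹ • w.1)
    have h3 : ‖c ^ 2 * u - c ^ 3 * f w‖ = ‖u - c * f w‖ := by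
      rw [show c ^ 2 * u - c ^ 3 * f w = c ^ 2 * (u - c * f w) by ring, norm_mul, norm_pow, hc,
        one_pow, one_mul]
    have h4 : ‖c - 1‖ = ‖(u - f w) - (u - c * f w)‖ := by
      rw [show (u - f w) - (u - c * f w) = (c - 1) * f w by ring, norm_mul, hfw, mul_one]
    rw [e3, e4, h3, h4, add_comm]
    exact norm_sub_le _ _
  unfold defect
  rw [zeroExtend_coe, zeroExtend_coe]
  set X := ‖zeroExtend f (L⁻¹ • (Φ v).1) - f (Φ v)‖
  set Y := ‖zeroExtend f (L⁻¹ • w.1) - f w‖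
  have hX : 0 ≤ X := norm_nonneg _
  have hY : 0 ≤ Y := norm_nonneg _
  rcases le_total 1 X with h | h
  · rw [min_eq_left h]
    linarith [min_le_left 1 ‖c - 1‖, le_min zero_le_one hY]
  rcases le_total 1 Y with h' | h'
  · rw [min_eq_left h']
    linarith [min_le_left 1 ‖c - 1‖, le_min zero_le_one hX]
  rw [min_eq_right h, min_eq_right h']
  exact (min_le_right _ _).trans e5

/-- A lower bound for the integrated defect of an eigenfunction. -/
theorem mul_vol_base_le (hfm : Measurable f) (hf : ∀ v, f (Φ v) = c * f v) (hc : ‖c‖ = 1)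
    (hf1 : ∀ᵐ v ∂vol, ‖f v‖ = 1) {N : ℕ} (hN : 13 ≤ N) {ε : ℝ} (hε0 : 0 < ε) (hε : ε ≤ 1 / 5) :
    ENNReal.ofReal (min 1 ‖c - 1‖) * (ENNReal.ofReal (N / 2) * volume (base N ε)) ≤
    2 * ∫⁻ v, ENNReal.ofReal (defect f (1 - ε) v.1 * roof v) ∂vol := by
  set E : Set Ω := Subtype.val ⁻¹' base N ε with hE
  have hEm : MeasurableSet E := measurable_subtype_coe (measurableSet_base N ε)
  have hvolE : vol E = volume (base N ε) := by
    rw [vol_apply, hE, Subtype.image_preimage_coe, inter_eq_right.2 (base_subset hε)]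
  -- The reflected function has eigenvalue `c⁻¹`; its forward tower estimate is the backward one for
  -- `f`, which handles the defect at `Ψ (Ψ v)`.
  set f' : Ω → ℂ := f ∘ swap with hf'
  have hf'm : Measurable f' := hfm.comp measurable_swap
  have hc0 : c ≠ 0 := by rintro rfl; simp at hc
  have hf'eig : ∀ v, f' (Φ v) = c⁻¹ * f' v := by
    intro v
    have h1 : f (Φ (swap (Φ v))) = c * f (swap (Φ v)) := hf _
    rw [Φ_swap_Φ] at h1
    simp only [hf', Function.comp_apply, h1, inv_mul_cancel_left₀ hc0]
  have hf'1 : ∀ᵐ v ∂vol, ‖f' v‖ = 1 := measurePreserving_swap.quasiMeasurePreserving.ae hf1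
  have h1 := setLIntegral_defect_le hfm hf hc hf1 hN hε0 hε
  have h2 := setLIntegral_defect_le hf'm hf'eig (by rw [norm_inv, hc, inv_one]) hf'1 hN hε0 hε
  have hdm : Measurable fun v : Ω => defect f (1 - ε) v.1 :=
    (measurable_defect hfm (1 - ε)).comp measurable_subtype_coe
  have h3 : ∫⁻ v, ENNReal.ofReal (defect f' (1 - ε) v.1 * roof v) ∂vol =
      ∫⁻ v, ENNReal.ofReal (defect f (1 - ε) v.1 * roof v) ∂vol := by
    have hG : Measurable fun v : Ω => ENNReal.ofReal (defect f (1 - ε) v.1 * roof v) :=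
      (hdm.mul measurable_roof).ennreal_ofReal
    rw [← measurePreserving_swap.lintegral_comp hG]
    simp only [hf', defect_comp_swap, roof_swap]
  have hσ : MeasurePreserving (Φ ∘ swap) vol vol :=
    measurePreserving_Φ_vol.comp measurePreserving_swap
  have hσE : (Φ ∘ swap) ⁻¹' E = E := by
    ext v
    constructor
    · intro h
      have := Φ_swap_mem_base hε (v := Φ (swap v)) h
      rwa [Φ_swap_Φ, swap_swap] at this
    · exact fun h => Φ_swap_mem_base hε h
  have h4 : ∫⁻ v in E, ENNReal.ofReal (defect f' (1 - ε) (Φ v).1) ∂vol =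
      ∫⁻ v in E, ENNReal.ofReal (defect f (1 - ε) (Ψ (Ψ v)).1) ∂vol := by
    have hm : Measurable fun v : Ω => ENNReal.ofReal (defect f' (1 - ε) (Φ v).1) :=
      (((measurable_defect hf'm (1 - ε)).comp measurable_subtype_coe).comp
        measurable_Φ).ennreal_ofReal
    rw [← hσ.setLIntegral_comp_preimage hEm hm, hσE]
    simp only [hf', defect_comp_swap]
    rfl
  rw [h3, h4] at h2
  have hdΦ : Measurable fun v : Ω => ENNReal.ofReal (defect f (1 - ε) (Φ v).1) :=
    (hdm.comp measurable_Φ).ennreal_ofReal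
  rw [two_mul]
  refine le_trans ?_ (add_le_add h1 h2)
  rw [← mul_add, ← lintegral_add_left hdΦ, mul_left_comm]
  gcongr
  rw [← hvolE, ← setLIntegral_const]
  refine lintegral_mono_ae ?_
  filter_upwards [ae_restrict_of_ae hf1, ae_restrict_mem hEm] with v hv1 hv2
  rw [← ENNReal.ofReal_add (defect_nonneg _ _ _) (defect_nonneg _ _ _)]
  exact ENNReal.ofReal_le_ofReal (min_le_defect_add_defect hf hc hε0 hε hv2 hv1)

end Eigenfunction

end BCZ

/-! ### Area of the base and integrability of the roof. -/

namespace BCZ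
open Filter Topology Set

/-- For fixed `a`, each `q` excludes at most `q + 2` intervals of length `2 ε / q`, hence at most `6
ε`. All `q ≤ N` together exclude at most `6 / 50` of an interval of length `a / 2`. -/
theorem ofReal_le_volume_base {N : ℕ} (hN : 13 ≤ N) {ε : ℝ} (hε : ε = 1 / (50 * N)) :
    ENNReal.ofReal (ε / 5) ≤ volume (base N ε) := by
  have hN' : (13 : ℝ) ≤ N := by exact_mod_cast hN
  have hε0 : 0 < ε := by rw [hε]; positivity
  have hεN : ε * N = 1 / 50 := by rw [hε]; field_simp
  have hε5 : ε ≤ 1 / 50 := by nlinarith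
  have hsec : ∀ a ∈ Ioc (1 - ε) 1,
      ENNReal.ofReal (1 / 5) ≤ volume (Prod.mk a ⁻¹' base N ε) := by
    rintro a ⟨ha1, ha2⟩
    set B : Set ℝ := ⋃ q ∈ Finset.Icc 1 N, ⋃ p ∈ Finset.range (q + 2),
      Metric.ball ((p : ℝ) * a / q) (ε / q) with hB
    have hsub : Icc (a / 4) (3 * a / 4) \ B ⊆ Prod.mk a ⁻¹' base N ε := by
      rintro b ⟨⟨hb1, hb2⟩, hbB⟩
      refine ⟨ha1, ha2, hb1, hb2, fun q hq1 hqN p => ?_⟩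
      by_contra hlt
      rw [not_le, abs_lt] at hlt
      obtain ⟨hlt1, hlt2⟩ := hlt
      dsimp only at hlt1 hlt2
      have hq : (1 : ℝ) ≤ q := by exact_mod_cast hq1
      have hp0 : (p : ℝ) < 0 := by
        by_contra h
        rw [not_lt] at h
        nlinarith [mul_nonneg h (by linarith : (0 : ℝ) ≤ a)]
      have hp0' : 0 ≤ -p := by
        have : p < 0 := by exact_mod_cast hp0
        omega
      obtain ⟨k, hk⟩ := Int.eq_ofNat_of_zero_le hp0'
      have hkR : (p : ℝ) = -k := by
        have : -(p : ℝ) = k := by exact_mod_cast hk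
        linarith
      rw [hkR] at hlt1 hlt2
      have hkq : k < q + 2 := by
        have : (k : ℝ) < q + 1 := by
          by_contra h
          rw [not_lt] at h
          nlinarith [mul_le_mul_of_nonneg_right h (by linarith : (0 : ℝ) ≤ a)]
        have : k < q + 1 := by exact_mod_cast this
        omega
      apply hbB
      simp only [hB, mem_iUnion]
      refine ⟨q, Finset.mem_Icc.2 ⟨hq1, hqN⟩, k, Finset.mem_range.2 hkq, ?_⟩
      rw [Metric.mem_ball, Real.dist_eq, abs_lt]
      have hq0 : (0 : ℝ) < q := by linarith
      have e : b - k * a / q = (q * b - k * a) / q := by field_simp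
      rw [e, ← neg_div]
      constructor
      · exact div_lt_div_of_pos_right (by linarith) hq0
      · exact div_lt_div_of_pos_right (by linarith) hq0
    have hvB : volume B ≤ ENNReal.ofReal (1 / 5) := by
      calc volume B ≤ ∑ q ∈ Finset.Icc 1 N, volume (⋃ p ∈ Finset.range (q + 2),
            Metric.ball ((p : ℝ) * a / q) (ε / q)) := measure_biUnion_finset_le _ _
        _ ≤ ∑ q ∈ Finset.Icc 1 N, ENNReal.ofReal (6 * ε) := by
            refine Finset.sum_le_sum fun q hq => ?_
            have hq1 : (1 : ℝ) ≤ q := by exact_mod_cast (Finset.mem_Icc.1 hq).1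
            refine (measure_biUnion_finset_le _ _).trans ?_
            simp only [Real.volume_ball, Finset.sum_const, Finset.card_range, nsmul_eq_mul]
            rw [← ENNReal.ofReal_natCast, ← ENNReal.ofReal_mul (by positivity)]
            apply ENNReal.ofReal_le_ofReal
            push_cast
            rw [mul_div_assoc', mul_div_assoc', div_le_iff₀ (by linarith)]
            nlinarith
        _ ≤ ENNReal.ofReal (1 / 5) := by
            rw [Finset.sum_const, Nat.card_Icc, nsmul_eq_mul, ← ENNReal.ofReal_natCast,
              ← ENNReal.ofReal_mul (by positivity)]
            apply ENNReal.ofReal_le_ofReal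
            push_cast [Nat.add_sub_cancel]
            linarith
    calc ENNReal.ofReal (1 / 5) ≤ ENNReal.ofReal (3 * a / 4 - a / 4) - ENNReal.ofReal (1 / 5) := by
          rw [← ENNReal.ofReal_sub _ (by norm_num)]
          apply ENNReal.ofReal_le_ofReal
          linarith
      _ ≤ volume (Icc (a / 4) (3 * a / 4)) - volume B := by
          rw [Real.volume_Icc]
          exact tsub_le_tsub_left hvB _
      _ ≤ volume (Icc (a / 4) (3 * a / 4) \ B) := le_measure_sdiff
      _ ≤ _ := measure_mono hsub
  rw [Measure.volume_eq_prod, Measure.prod_apply (measurableSet_base N ε)]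
  calc ENNReal.ofReal (ε / 5) = ∫⁻ _ in Ioc (1 - ε) 1, ENNReal.ofReal (1 / 5) := by
        rw [setLIntegral_const, Real.volume_Ioc, ← ENNReal.ofReal_mul (by norm_num)]
        congr 1; ring
    _ ≤ ∫⁻ a in Ioc (1 - ε) 1, volume (Prod.mk a ⁻¹' base N ε) :=
        setLIntegral_mono' measurableSet_Ioc hsec
    _ ≤ _ := setLIntegral_le_lintegral _ _

/-- The section of the triangle over `s` has length `s`, which cancels the singularity. -/
theorem lintegral_inv_fst_le : ∫⁻ v, ENNReal.ofReal (1 / v.1.1) ∂vol ≤ 1 := by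
  have hm : Measurable fun x : ℝ × ℝ => ENNReal.ofReal (1 / x.1) := by fun_prop
  rw [lintegral_vol (fun x => ENNReal.ofReal (1 / x.1)), ← lintegral_indicator measurableSet_Ω,
    Measure.volume_eq_prod, lintegral_prod _ (hm.indicator measurableSet_Ω).aemeasurable]
  calc _ ≤ ∫⁻ a : ℝ, (Ioc (0 : ℝ) 1).indicator (fun _ => 1) a := by
        refine lintegral_mono fun a => ?_
        by_cases ha : a ∈ Ioc (0 : ℝ) 1
        · rw [indicator_of_mem ha]
          calc _ ≤ ∫⁻ b : ℝ, (Ioc (1 - a) 1).indicator (fun _ => ENNReal.ofReal (1 / a)) b := by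
                refine lintegral_mono fun b => ?_
                by_cases hab : (a, b) ∈ Ω
                · rw [indicator_of_mem hab, indicator_of_mem]
                  obtain ⟨-, -, -, h4, h5⟩ := hab
                  exact ⟨by dsimp only at h5; linarith, h4⟩
                · rw [indicator_of_notMem hab]; exact zero_le
            _ = 1 := by
                rw [lintegral_indicator measurableSet_Ioc, setLIntegral_const, Real.volume_Ioc,
                  ← ENNReal.ofReal_mul (one_div_nonneg.2 ha.1.le), sub_sub_cancel,
                  one_div_mul_cancel ha.1.ne', ENNReal.ofReal_one]
        · have : ∀ b, (a, b) ∉ Ω := fun b hb => ha ⟨hb.1, hb.2.1⟩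
          simp [this]
    _ = 1 := by rw [lintegral_indicator measurableSet_Ioc]; simp

/-- Since `s + t > 1`, the roof is below `1 / s + 1 / t`. -/
theorem lintegral_roof_ne_top : ∫⁻ v, ENNReal.ofReal (roof v) ∂vol ≠ ⊤ := by
  have hm : Measurable fun v : Ω => ENNReal.ofReal (1 / v.1.1) := by fun_prop
  have h2 : ∫⁻ v, ENNReal.ofReal (1 / v.1.2) ∂vol ≤ 1 := by
    have := measurePreserving_swap.lintegral_comp hm
    simp only [swap_fst] at this
    rw [this]
    exact lintegral_inv_fst_le
  have h3 : ∫⁻ v, ENNReal.ofReal (roof v) ∂vol ≤ 1 + 1 := by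
    refine le_trans ?_ (add_le_add lintegral_inv_fst_le h2)
    rw [← lintegral_add_left hm]
    refine lintegral_mono fun v => ?_
    obtain ⟨a0, a1, b0, b1, ab⟩ := v.2
    rw [← ENNReal.ofReal_add (one_div_nonneg.2 a0.le) (one_div_nonneg.2 b0.le)]
    apply ENNReal.ofReal_le_ofReal
    rw [roof, div_add_div _ _ a0.ne' b0.ne']
    gcongr
    linarith
  exact ne_top_of_le_ne_top (by norm_num) h3

end BCZ

/-! ### Continuity of dilation. -/

section Dilation
open Filter Topology Set

/-- Dilation is continuous in `L¹`. -/
theorem tendsto_integral_norm_dilation_sub {E : Type*} [NormedAddCommGroup E] [NormedSpace ℝ E]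
    [FiniteDimensional ℝ E] [MeasurableSpace E] [BorelSpace E] {μ : Measure E}
    [μ.IsAddHaarMeasure] {F : E → ℂ} (hF : Integrable F μ) {l : ℕ → ℝ} (h1 : ∀ n, 1 ≤ l n)
    (hl : Tendsto l atTop (𝓝 1)) :
    Tendsto (fun n => ∫ x, ‖F (l n • x) - F x‖ ∂μ) atTop (𝓝 0) := by
  rw [Metric.tendsto_atTop]
  intro η hη
  obtain ⟨φ, hφs, hφF, hφc, hφi⟩ := hF.exists_hasCompactSupport_integral_sub_le
    (ε := η / 4) (by positivity)
  have hl0 : ∀ n, l n ≠ 0 := fun n => (zero_lt_one.trans_le (h1 n)).ne'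
  have hlim : Tendsto (fun n => ∫ x, ‖φ (l n • x) - φ x‖ ∂μ) atTop (𝓝 (∫ _, (0 : ℝ) ∂μ)) := by
    obtain ⟨C, hC⟩ := hφc.bounded_above_of_compact_support hφs
    obtain ⟨r, hr⟩ := hφs.isCompact.isBounded.subset_closedBall (0 : E)
    have hzero : ∀ x, x ∉ Metric.closedBall (0 : E) r → φ x = 0 := fun x hx =>
      image_eq_zero_of_notMem_tsupport fun h => hx (hr h)
    refine tendsto_integral_of_dominated_convergence
      ((Metric.closedBall (0 : E) r).indicator fun _ => C + C) ?_ ?_ ?_ ?_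
    · intro n
      exact ((hφc.comp (continuous_const_smul _)).sub hφc).norm.aestronglyMeasurable
    · exact (integrable_indicator_iff Metric.isClosed_closedBall.measurableSet).2
        (integrableOn_const (isCompact_closedBall _ _).measure_lt_top.ne)
    · intro n
      refine Eventually.of_forall fun x => ?_
      rw [norm_norm]
      by_cases hx : x ∈ Metric.closedBall (0 : E) r
      · rw [indicator_of_mem hx]
        exact (norm_sub_le _ _).trans (add_le_add (hC _) (hC _))
      · rw [indicator_of_notMem hx, hzero x hx, hzero, sub_zero, norm_zero]
        -- As `l n ≥ 1`, a point outside the ball stays outside, so one ball dominates all `n`.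
        rw [mem_closedBall_zero_iff, not_le] at hx ⊢
        rw [norm_smul, Real.norm_of_nonneg (zero_le_one.trans (h1 n))]
        nlinarith [h1 n, norm_nonneg x]
    · refine Eventually.of_forall fun x => ?_
      have h2 : Tendsto (fun n => l n • x) atTop (𝓝 ((1 : ℝ) • x)) := hl.smul_const x
      rw [one_smul] at h2
      have h3 := ((hφc.tendsto x).comp h2).sub_const (φ x)
      rw [sub_self] at h3
      simpa using h3.norm
  rw [integral_zero, Metric.tendsto_atTop] at hlim
  obtain ⟨n₀, hn₀⟩ := hlim (η / 2) (by positivity)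
  refine ⟨n₀, fun n hn => ?_⟩
  have h2 := hn₀ n hn
  rw [Real.dist_eq, sub_zero, abs_of_nonneg (integral_nonneg fun _ => norm_nonneg _)] at h2 ⊢
  have hd : Integrable (fun x => ‖F x - φ x‖) μ := (hF.sub hφi).norm
  have hdl : Integrable (fun x => ‖F (l n • x) - φ (l n • x)‖) μ := hd.comp_smul (hl0 n)
  have hφl : Integrable (fun x => ‖φ (l n • x) - φ x‖) μ :=
    ((hφi.comp_smul (hl0 n)).sub hφi).norm
  have hsum : Integrable (fun x => ‖F (l n • x) - φ (l n • x)‖ + ‖φ (l n • x) - φ x‖) μ :=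
    hdl.add hφl
  have h3 : ∫ x, ‖F (l n • x) - φ (l n • x)‖ ∂μ ≤ ∫ x, ‖F x - φ x‖ ∂μ := by
    rw [Measure.integral_comp_smul μ (fun x => ‖F x - φ x‖), smul_eq_mul]
    refine mul_le_of_le_one_left (integral_nonneg fun _ => norm_nonneg _) ?_
    rw [abs_of_nonneg (inv_nonneg.2 (pow_nonneg (zero_le_one.trans (h1 n)) _))]
    exact inv_le_one_of_one_le₀ (one_le_pow₀ (h1 n))
  have h4 : ∫ x, ‖F (l n • x) - F x‖ ∂μ ≤
      ∫ x, ((‖F (l n • x) - φ (l n • x)‖ + ‖φ (l n • x) - φ x‖) + ‖F x - φ x‖) ∂μ := by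
    refine integral_mono ((hF.comp_smul (hl0 n)).sub hF).norm (hsum.add hd) fun x => ?_
    have e : F (l n • x) - F x =
      (F (l n • x) - φ (l n • x)) + (φ (l n • x) - φ x) - (F x - φ x) := by ring
    dsimp only
    rw [e]
    exact (norm_sub_le _ _).trans (by gcongr; exact norm_add_le _ _)
  rw [integral_add hsum hd, integral_add hdl hφl] at h4
  linarith

end Dilation

/-! ### The only eigenvalue is one. -/

namespace BCZ
open Filter Topology Set

/-- A unimodular eigenfunction has eigenvalue one. -/
theorem eigenvalue_eq_one_of_forall {f : Ω → ℂ} {c : ℂ} (hfm : Measurable f)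
    (hf : ∀ v, f (Φ v) = c * f v) (hc : ‖c‖ = 1) (hf1 : ∀ᵐ v ∂vol, ‖f v‖ = 1) : c = 1 := by
  have hint : Integrable (zeroExtend f) := by
    have h1 : IntegrableOn (zeroExtend f) Ω := by
      refine Measure.integrableOn_of_bounded (M := 1) volume_Ω_ne_top
        (measurable_zeroExtend hfm).aestronglyMeasurable ?_
      rw [← measurePreserving_val.map_eq,
        (MeasurableEmbedding.subtype_coe measurableSet_Ω).ae_map_iff]
      filter_upwards [hf1] with v hv
      rw [zeroExtend_coe, hv]
    rw [← integrable_indicator_iff measurableSet_Ω] at h1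
    refine h1.congr (Eventually.of_forall fun x => ?_)
    by_cases hx : x ∈ Ω
    · rw [indicator_of_mem hx]
    · rw [indicator_of_notMem hx, zeroExtend_of_notMem f hx]
  set ε : ℕ → ℝ := fun n => 1 / (50 * (n + 13 : ℕ)) with hε
  have hε0 : ∀ n, 0 < ε n := fun n => by simp only [hε]; positivity
  have hεN : ∀ n, ε n * (n + 13 : ℕ) = 1 / 50 := fun n => by simp only [hε]; field_simp
  have hε5 : ∀ n, ε n ≤ 1 / 5 := fun n => by
    have h1 := hεN n
    have h2 : (1 : ℝ) ≤ (n + 13 : ℕ) := by push_cast; linarith [(Nat.cast_nonneg n : (0 : ℝ) ≤ n)]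
    nlinarith [hε0 n]
  have hεlim : Tendsto ε atTop (𝓝 0) := by
    have h1 : Tendsto (fun n : ℕ => 50 * ((n + 13 : ℕ) : ℝ)) atTop atTop :=
      (tendsto_natCast_atTop_atTop.comp (tendsto_add_atTop_nat 13)).const_mul_atTop (by norm_num)
    simpa only [hε, one_div, Function.comp_def] using tendsto_inv_atTop_zero.comp h1
  have hl : Tendsto (fun n => (1 - ε n)⁻¹) atTop (𝓝 1) := by
    have := (tendsto_const_nhds (x := (1 : ℝ))).sub hεlim
    rw [sub_zero] at this
    simpa using this.inv₀ one_ne_zero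
  have hl1 : ∀ n, 1 ≤ (1 - ε n)⁻¹ := fun n =>
    (one_le_inv₀ (by linarith [hε5 n])).2 (by linarith [hε0 n])
  have hdil := tendsto_integral_norm_dilation_sub hint hl1 hl
  have hmeas : TendstoInMeasure volume (fun n x => zeroExtend f ((1 - ε n)⁻¹ • x)) atTop
      (zeroExtend f) := by
    refine tendstoInMeasure_of_tendsto_eLpNorm one_ne_zero (fun n => ?_)
      hint.aestronglyMeasurable ?_
    · exact (hint.comp_smul (zero_lt_one.trans_le (hl1 n)).ne').aestronglyMeasurable
    · have h1 := ENNReal.tendsto_ofReal hdil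
      rw [ENNReal.ofReal_zero] at h1
      refine h1.congr fun n => ?_
      rw [eLpNorm_one_eq_lintegral_enorm, ofReal_integral_norm_eq_lintegral_enorm]
      · rfl
      · exact (hint.comp_smul (zero_lt_one.trans_le (hl1 n)).ne').sub hint
  obtain ⟨ns, hns, hae⟩ := hmeas.exists_seq_tendsto_ae
  have hlim : Tendsto (fun k => ∫⁻ v, ENNReal.ofReal (defect f (1 - ε (ns k)) v.1 * roof v) ∂vol)
      atTop (𝓝 (∫⁻ _, 0 ∂vol)) := by
    refine tendsto_lintegral_of_dominated_convergence (fun v => ENNReal.ofReal (roof v))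
      (fun k => ?_) (fun k => ?_) lintegral_roof_ne_top ?_
    · exact (((measurable_defect hfm _).comp measurable_subtype_coe).mul
        measurable_roof).ennreal_ofReal
    · refine Eventually.of_forall fun v => ENNReal.ofReal_le_ofReal ?_
      exact mul_le_of_le_one_left (zero_le_one.trans (one_le_roof v)) (min_le_left _ _)
    · have h1 := measurePreserving_val.quasiMeasurePreserving.ae (ae_restrict_of_ae hae)
      filter_upwards [h1] with v hv
      have h2 := (tendsto_const_nhds (x := (1 : ℝ))).min ((hv.sub_const (zeroExtend f v.1)).norm)
      rw [sub_self, norm_zero, min_eq_right zero_le_one] at h2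
      have h3 := ENNReal.tendsto_ofReal (h2.mul_const (roof v))
      rwa [zero_mul, ENNReal.ofReal_zero] at h3
  rw [lintegral_zero] at hlim
  by_contra hc1
  set κ := min 1 ‖c - 1‖ with hκ
  have hκ0 : 0 < κ := lt_min one_pos (norm_pos_iff.2 (sub_ne_zero.2 hc1))
  -- With `ε * N = 1 / 50`, the product `(N / 2) * (ε / 5)` is `1 / 500` for every `k`.
  have hlow : ∀ k, ENNReal.ofReal (κ / 500) ≤
      2 * ∫⁻ v, ENNReal.ofReal (defect f (1 - ε (ns k)) v.1 * roof v) ∂vol := by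
    intro k
    have hN : 13 ≤ ns k + 13 := by omega
    refine le_trans ?_ (mul_vol_base_le hfm hf hc hf1 hN (hε0 _) (hε5 _))
    calc ENNReal.ofReal (κ / 500)
        = ENNReal.ofReal κ * (ENNReal.ofReal ((ns k + 13 : ℕ) / 2) *
          ENNReal.ofReal (ε (ns k) / 5)) := by
          rw [← ENNReal.ofReal_mul (by positivity), ← ENNReal.ofReal_mul hκ0.le]
          congr 1
          linear_combination (-κ / 10) * hεN (ns k)
      _ ≤ _ := by
          gcongr
          exact ofReal_le_volume_base hN rfl
  have hlim2 := ENNReal.Tendsto.const_mul (a := 2) hlim (Or.inr (by norm_num))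
  rw [mul_zero] at hlim2
  have := ge_of_tendsto' hlim2 hlow
  rw [nonpos_iff_eq_zero, ENNReal.ofReal_eq_zero] at this
  linarith

/-- A function that is almost everywhere unimodular and almost everywhere an eigenfunction has
eigenvalue one. -/
theorem eigenvalue_eq_one {f : Ω → ℂ} {c : ℂ} (hfm : Measurable f)
    (hf : ∀ᵐ v ∂vol, f (Φ v) = c * f v) (hf1 : ∀ᵐ v ∂vol, ‖f v‖ = 1) : c = 1 := by
  set good : Set Ω := {v | f (Φ v) = c * f v ∧ ‖f v‖ = 1} with hgood
  have hgm : MeasurableSet good :=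
    (measurableSet_eq_fun (hfm.comp measurable_Φ) (measurable_const.mul hfm)).inter
      (measurableSet_eq_fun hfm.norm measurable_const)
  set X : Set Ω := {v | ∀ n, Φ^[n] v ∈ good ∧ Ψ^[n] v ∈ good} with hX
  have hXm : MeasurableSet X := by
    have : X = ⋂ n, (Φ^[n] ⁻¹' good ∩ Ψ^[n] ⁻¹' good) := by ext v; simp [hX]
    rw [this]
    exact .iInter fun n => (measurable_Φ.iterate n hgm).inter
      (measurePreserving_Ψ.measurable.iterate n hgm)
  have hXae : ∀ᵐ v ∂vol, v ∈ X := by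
    have hg : ∀ᵐ v ∂vol, v ∈ good := by
      filter_upwards [hf, hf1] with v h1 h2 using ⟨h1, h2⟩
    refine ae_all_iff.2 fun n => ?_
    filter_upwards [(measurePreserving_Φ_vol.iterate n).quasiMeasurePreserving.ae hg,
      (measurePreserving_Ψ.iterate n).quasiMeasurePreserving.ae hg] with v h1 h2 using ⟨h1, h2⟩
  have hXinv : ∀ v, Φ v ∈ X ↔ v ∈ X := by
    intro v
    constructor
    · intro h n
      refine ⟨?_, by simpa [Function.iterate_succ_apply, Ψ_Φ] using (h (n + 1)).2⟩
      cases n with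
      | zero => simpa [Ψ_Φ] using (h 1).2
      | succ n => exact (h n).1
    · intro h n
      refine ⟨(h (n + 1)).1, ?_⟩
      cases n with
      | zero => exact (h 1).1
      | succ n => simpa [Function.iterate_succ_apply, Ψ_Φ] using (h n).2
  have hvol : vol ≠ 0 := fun h0 => volume_Ω_ne_zero (by
    have := vol_apply univ
    rwa [h0, image_univ, Subtype.range_coe, Measure.coe_zero, Pi.zero_apply, eq_comm] at this)
  have : (ae vol).NeBot := ae_neBot.2 hvol
  obtain ⟨v₀, hv₀⟩ := hXae.exists
  have hc : ‖c‖ = 1 := by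
    have h1 := (hv₀ 0).1.1
    have h2 := (hv₀ 1).1.2
    have h3 := (hv₀ 0).1.2
    simp only [Function.iterate_zero, id, Function.iterate_one] at h1 h2 h3
    rw [h1, norm_mul, h3, mul_one] at h2
    exact h2
  -- Cutting off to an invariant set of full measure makes the eigenvalue equation hold everywhere.
  refine eigenvalue_eq_one_of_forall (f := X.indicator f) (hfm.indicator hXm) (fun v => ?_) hc ?_
  · by_cases hv : v ∈ X
    · rw [indicator_of_mem hv, indicator_of_mem ((hXinv v).2 hv)]
      exact (hv 0).1.1
    · rw [indicator_of_notMem hv, indicator_of_notMem (fun h => hv ((hXinv v).1 h)), mul_zero]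
  · filter_upwards [hXae] with v hv
    rw [indicator_of_mem hv]
    exact (hv 0).1.2

/-- An almost everywhere nonzero eigenfunction has eigenvalue one. -/
theorem eigenvalue_eq_one_of_ae_ne_zero {f : Ω → ℂ} {c : ℂ} (hc : c ≠ 0) (hfm : Measurable f)
    (hf : ∀ᵐ v ∂vol, f (Φ v) = c * f v) (hf0 : ∀ᵐ v ∂vol, f v ≠ 0) : c = 1 := by
  have harg : c / ‖c‖ = 1 := by
    refine eigenvalue_eq_one (f := fun v => f v / ‖f v‖) (by fun_prop) ?_ ?_
    · filter_upwards [hf] with v hv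
      rw [hv, norm_mul, Complex.ofReal_mul, mul_div_mul_comm]
    · filter_upwards [hf0] with v hv
      simp [hv]
  have hlog : Real.log ‖c‖ = 0 := by
    by_contra hne
    -- If `‖c‖ ≠ 1`, then `exp (i s log ‖f‖)` is a unimodular eigenfunction, and this `s` makes its
    -- eigenvalue `-1`. No integrability of `f` is needed.
    set s := Real.pi / Real.log ‖c‖ with hs
    have h1 : Complex.exp ((s * Real.log ‖c‖ : ℝ) * Complex.I) = 1 := by
      refine eigenvalue_eq_one
        (f := fun v => Complex.exp ((s * Real.log ‖f v‖ : ℝ) * Complex.I)) ?_ ?_ ?_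
      · exact Complex.measurable_exp.comp ((Complex.measurable_ofReal.comp
          ((Real.measurable_log.comp hfm.norm).const_mul s)).mul_const _)
      · filter_upwards [hf, hf0] with v hv hv0
        rw [hv, norm_mul, Real.log_mul (norm_ne_zero_iff.2 hc) (norm_ne_zero_iff.2 hv0),
          ← Complex.exp_add]
        congr 1
        push_cast; ring
      · exact Eventually.of_forall fun v => Complex.norm_exp_ofReal_mul_I _
    rw [hs, div_mul_cancel₀ _ hne, Complex.exp_pi_mul_I] at h1
    norm_num at h1
  have hnorm : ‖c‖ = 1 := Real.eq_one_of_pos_of_log_eq_zero (norm_pos_iff.2 hc) hlog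
  rwa [hnorm, Complex.ofReal_one, div_one] at harg

end BCZ

/-! ### Conclusion. -/

theorem theorem1 : WeaklyMixing BCZ.Φ BCZ.m := by
  refine ⟨BCZ.ergodic_Φ, fun c f hfm hf => ?_⟩
  have hg := hfm.stronglyMeasurable_mk.measurable
  have hfg := hfm.ae_eq_mk
  set g := hfm.mk f
  have hgeig : ∀ᵐ v ∂BCZ.m, g (BCZ.Φ v) = c * g v := by
    filter_upwards [hf, hfg, BCZ.measurePreserving_Φ.quasiMeasurePreserving.ae hfg] with v h1 h2 h3
    rw [← h3, h1, h2]
  suffices h : ∃ a : ℂ, ∀ᵐ v ∂BCZ.m, g v = a by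
    obtain ⟨a, ha⟩ := h
    exact ⟨a, by filter_upwards [ha, hfg] with v h1 h2 using h2.trans h1⟩
  by_cases hc0 : c = 0
  · refine ⟨0, BCZ.ae_m_iff.2 ?_⟩
    filter_upwards [BCZ.measurePreserving_Ψ.quasiMeasurePreserving.ae (BCZ.ae_m_iff.1 hgeig)]
      with v hv
    rwa [BCZ.Φ_Ψ, hc0, zero_mul] at hv
  have hzm : MeasurableSet {v | g v = 0} := measurableSet_eq_fun hg measurable_const
  -- For `c ≠ 0` the zero set is invariant, so by ergodicity `g` vanishes almost everywhere or
  -- almost nowhere.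
  have hz : BCZ.Φ ⁻¹' {v | g v = 0} =ᵐ[BCZ.m] {v | g v = 0} := by
    filter_upwards [hgeig] with v hv
    refine propext ?_
    change g (BCZ.Φ v) = 0 ↔ g v = 0
    rw [hv, mul_eq_zero, or_iff_right hc0]
  rcases BCZ.ergodic_Φ.quasiErgodic.ae_empty_or_univ₀ hzm.nullMeasurableSet hz with h | h
  · have hne : ∀ᵐ v ∂BCZ.m, g v ≠ 0 := by
      filter_upwards [h] with v hv hv0
      exact (hv.mp hv0 : False)
    have hc1 := BCZ.eigenvalue_eq_one_of_ae_ne_zero hc0 hg (BCZ.ae_m_iff.1 hgeig)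
      (BCZ.ae_m_iff.1 hne)
    obtain ⟨a, ha⟩ := BCZ.ergodic_Φ.ae_eq_const_of_ae_eq_comp_ae hg.aestronglyMeasurable
      (by filter_upwards [hgeig] with v hv; rw [Function.comp_apply, hv, hc1, one_mul])
    exact ⟨a, ha⟩
  · refine ⟨0, ?_⟩
    filter_upwards [h] with v hv
    exact hv.mpr trivial
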